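/- **Model.** Let $D,g\ge 0$ be integers and $\tau>0$. For a covariate vector $x\in\mathbb R^D$ and parameters $\Phi=(\alpha,\beta,\phi,\theta,\nu)$, with $\alpha=(\alpha_1,\dots,\alpha_g)$ and $\beta=(\beta_1,\dots,\beta_g)$ in $\mathbb R^{D\times g}$, $\phi\in(0,\infty)^g$, $\theta>0$, $\nu\in\mathbb R^D$, and with $\alpha_{g+1}=0$, consider the conditional density of a claim size $y>0$ $$h_Y(y;\Phi,x)=\sum_{j=1}^g\pi_j(x;\alpha)\frac{f(y;e^{\beta_j^Tx},\phi_j)}{F(\tau;e^{\beta_j^Tx},\phi_j)}1\{y\le\tau\}+\pi_{g+1}(x;\alpha)\frac{h(y;\theta,e^{\nu^Tx})}{1-H(\tau;\theta,e^{\nu^Tx})}1\{y>\tau\},\qquad \pi_j(x;\alpha)=\frac{e^{\alpha_j^Tx}}{\sum_{j'=1}^{g+1}e^{\alpha_{j'}^Tx}},$$ where $f(y;\mu,\phi)=\frac{(\phi\mu)^{-1/\phi}}{\Gamma(1/\phi)}y^{1/\phi-1}e^{-y/(\phi\mu)}$ (Gamma) and $h(y;\theta,\eta)=\eta\theta^\eta/(y+\theta)^{\eta+1}$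 (Lomax), with distribution functions $F$ and $H$. Let $V_i=(Y_i,x_i)$, $i\ge 1$, be i.i.d., where $x_i$ has an arbitrary law and $Y_i$ given $x_i$ has density $h_Y(\cdot;\Phi_0,x_i)$. Let the true parameter $\Phi_0$ be an interior point of the parameter space $\Omega$. Write $h(v;\Phi)=h_Y(y;\Phi,x)$ for $v=(y,x)$, which is the density of $V_i$ with respect to Lebesgue measure times the law of $x_i$, and let $\psi_1,\dots,\psi_Q$ be the coordinates of $\Phi$. Assume: * R1. The support of $h(\cdot;\Phi)$ is the same for all $\Phi\in\Omega$, and $\Phi\in\Omega$ is identifiable up to a permutation of the $g$ body components. * R2. For almost all $v$, $h(v;\cdot)$ is three times continuously differentiable at every $\Phi\in\Omega$. * R3. At $\Phi=\Phi_0$, $E[\partial_{\psi_i}\log h(V;\Phi)]=0$ and $E[\partial_{\psi_i}\log h(V;\Phi)\,\partial_{\psi_j}\log h(V;\Phi)]=E[-\partial_{\psi_i}\partial_{\psi_j}\log h(V;\Phi)]$ for all $i,j$. * R4. The Fisher information matrix of $\Phi$ is finite and positive definite at $\Phi_0$. * R5. There is a function $\mathcal M$ with $E[\mathcal M(V)]<\infty$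 such that, for all $\Phi$ in a neighbourhood of $\Phi_0$ and almost all $v$, all first, second and third partial derivatives of $\log h(v;\Phi)$ in $\Phi$ are bounded by $\mathcal M(v)$ in absolute value. **Penalized likelihood.** Let $c_{lk}\in\mathbb R^D$ ($l=1,2,3$; $k=1,\dots,K_l$) be fixed vectors, and put $\psi_{1k}(\Phi)=\|c_{1k}^T\alpha\|_2$, $\psi_{2k}(\Phi)=\|c_{2k}^T\beta\|_2$, $\psi_{3k}(\Phi)=|c_{3k}^T\nu|$. Let $\mathcal F_n=\mathcal L_n-\mathcal P_n$ with $\mathcal L_n(\Phi)=\sum_{i=1}^n\log h_Y(Y_i;\Phi,x_i)$ and $\mathcal P_n(\Phi)=\sum_{l=1}^3\sum_{k=1}^{K_l}p_{ln}(\psi_{lk}(\Phi);\lambda_{lkn})$; the penalty functions and the tuning parameters may depend on the data. Let $\mathcal Z_l=\{k:\psi_{lk}(\Phi_0)=0\}$. Write $q_{lkn}(\psi)=p_{ln}(\psi;\lambda_{lkn})$ and assume that $q_{lkn}$ is concave on $[0,\infty)$ and: * H1. $q_{lkn}(0)=0$, and $q_{lkn}$ is non-decreasing on $[0,\infty)$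 and twice differentiable on $(0,\infty)$ except in a finite set. * H2. For every $k\notin\mathcal Z_l$ and $C>0$: with probability tending to 1, $q_{lkn}$ is twice differentiable at every $\psi$ with $|\psi-\psi_{lk}(\Phi_0)|\le Cn^{-1/2}$, and $\sup\{|q''_{lkn}(\psi)|/n:|\psi-\psi_{lk}(\Phi_0)|\le Cn^{-1/2}\}=o_P(1)$. * H3. For every $k\in\mathcal Z_l$, $\inf\{q'_{lkn}(\psi)/\sqrt n:0<\psi\le n^{-1/2}\log n\}\to\infty$ in probability (the infimum being over points of differentiability). * H4. For every $k\notin\mathcal Z_l$, $q'_{lkn}(\psi_{lk}(\Phi_0))/\sqrt n=O_P(1)$. **Transformed parameters.** For $l=1,2,3$ let $\bar C_l=(\bar C_{\mathrm{red},l},\bar C_{\mathrm{ind},l})$ be an invertible $D\times D$ matrix whose first $m_l$ columns $\bar C_{\mathrm{red},l}$ are chosen among the vectors $c_{lk}$, $k\in\mathcal Z_l$, and span all of them. Put $\Phi^*=(\bar C_1^T\alpha,\bar C_2^T\beta,\phi,\theta,\bar C_3^T\nu)$ and $\mathcal F_n^*(\Phi^*)=\mathcal F_n(\Phi)$. Let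 $\Phi^*_{\mathrm{red}}$ consist of the first $m_1$, $m_2$, $m_3$ rows of $\bar C_1^T\alpha$, $\bar C_2^T\beta$, $\bar C_3^T\nu$ respectively, and $\Phi^*_{\mathrm{ind}}$ of all the other coordinates; thus $\Phi^*_{\mathrm{red},0}=0$ at the true parameter $\Phi_0^*$. The reduced model is the model with $\Phi^*_{\mathrm{red}}=0$ and parameter $\Phi^*_{\mathrm{ind}}$. Let $\mathcal I^*_{\mathrm{ind}}(\Phi^*_{\mathrm{ind},0})$ be its Fisher information matrix (for one observation) at $\Phi^*_{\mathrm{ind},0}$, and let ${\mathcal P_n^*}'(\Phi^*_{\mathrm{ind},0})$ and ${\mathcal P_n^*}''(\Phi^*_{\mathrm{ind},0})$ be the gradient and the Hessian at $\Phi^*_{\mathrm{ind},0}$ of the penalty as a function of $\Phi^*_{\mathrm{ind}}$ with $\Phi^*_{\mathrm{red}}=0$. **Theorem.** Let $\hat\Phi^*_n$ be any $\sqrt n$-consistent local maximizer of $\mathcal F_n^*$; that is, $\hat\Phi_n^*$ is a random vector that, with probability tending to 1, is a local maximizer of $\mathcal F_n^*$ over the transformed parameter space, and $\sqrt n\,\|\hat\Phi^*_n-\Phi^*_0\|_2=O_P(1)$.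 Then, as $n\to\infty$: (a) $P(\hat\Phi^*_{\mathrm{red},n}=0)\to1$; (b) $$\sqrt n\Big\{\big[\mathcal I^*_{\mathrm{ind}}(\Phi^*_{\mathrm{ind},0})-{\mathcal P_n^*}''(\Phi^*_{\mathrm{ind},0})/n\big]\big(\hat\Phi^*_{\mathrm{ind},n}-\Phi^*_{\mathrm{ind},0}\big)+{\mathcal P_n^*}'(\Phi^*_{\mathrm{ind},0})/n\Big\}\xrightarrow{d}N\big(0,\mathcal I^*_{\mathrm{ind}}(\Phi^*_{\mathrm{ind},0})\big).$$ -/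

import Mathlib

open MeasureTheory ProbabilityTheory Filter Topology Set
open scoped ENNReal

noncomputable section

/-! ### Parameters of the mixture composite regression model -/

/-- Coordinates of `Φ = (α, β, φ, θ, ν)` for `D` covariates and `g` body components. The columns
`α_1, …, α_g` are the free ones (`α_{g+1} = 0` is fixed). -/
abbrev ParIdx (D g : ℕ) : Type :=
  (Fin D × Fin g) ⊕ (Fin D × Fin g) ⊕ Fin g ⊕ Unit ⊕ Fin D

/-- The parameter vector `Φ`, with the Euclidean norm. -/
abbrev Par (D g : ℕ) : Type := EuclideanSpace ℝ (ParIdx D g)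

namespace Par

variable {D g : ℕ}

def alpha (Φ : Par D g) (d : Fin D) (j : Fin g) : ℝ := Φ (Sum.inl (d, j))
def beta (Φ : Par D g) (d : Fin D) (j : Fin g) : ℝ := Φ (Sum.inr (Sum.inl (d, j)))
def phi (Φ : Par D g) (j : Fin g) : ℝ := Φ (Sum.inr (Sum.inr (Sum.inl j)))
def theta (Φ : Par D g) : ℝ := Φ (Sum.inr (Sum.inr (Sum.inr (Sum.inl ()))))
def nu (Φ : Par D g) (d : Fin D) : ℝ := Φ (Sum.inr (Sum.inr (Sum.inr (Sum.inr d))))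

/-- Assemble a parameter vector from its blocks. -/
def mk (a b : Fin D → Fin g → ℝ) (p : Fin g → ℝ) (t : ℝ) (v : Fin D → ℝ) : Par D g :=
  WithLp.toLp 2 fun i => match i with
    | Sum.inl (d, j) => a d j
    | Sum.inr (Sum.inl (d, j)) => b d j
    | Sum.inr (Sum.inr (Sum.inl j)) => p j
    | Sum.inr (Sum.inr (Sum.inr (Sum.inl _))) => t
    | Sum.inr (Sum.inr (Sum.inr (Sum.inr d))) => v d

/-- Relabelling of the `g` body components. -/
def permute (σ : Equiv.Perm (Fin g)) (Φ : Par D g) : Par D g :=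
  mk (fun d j => Φ.alpha d (σ j)) (fun d j => Φ.beta d (σ j)) (fun j => Φ.phi (σ j)) Φ.theta Φ.nu

end Par

/-! ### The density of the model -/

/-- Gamma density with mean `μ` and dispersion `φ`. -/
def gammaDensity (μ φ y : ℝ) : ℝ :=
  if 0 < y then
    (φ * μ) ^ (-(1 / φ)) / Real.Gamma (1 / φ) * y ^ (1 / φ - 1) * Real.exp (-y / (φ * μ))
  else 0

/-- Gamma distribution function. -/
def gammaCdf (μ φ τ : ℝ) : ℝ := ∫ y in Iic τ, gammaDensity μ φ y

/-- Lomax (Pareto type II) density with scale `θ` and tail index `η`. -/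
def lomaxDensity (θ η y : ℝ) : ℝ :=
  if 0 < y then η * θ ^ η / (y + θ) ^ (η + 1) else 0

/-- Lomax distribution function. -/
def lomaxCdf (θ η τ : ℝ) : ℝ := ∫ y in Iic τ, lomaxDensity θ η y

/-- An observation `v = (y, x)`: a claim size and its covariate vector. -/
abbrev Obs (D : ℕ) : Type := ℝ × (Fin D → ℝ)

section Model

variable {D g : ℕ}

/-- `∑_{j' = 1}^{g+1} exp(α_{j'}ᵀ x)`, where the last summand is `exp 0 = 1`. -/
def weightDenom (Φ : Par D g) (x : Fin D → ℝ) : ℝ :=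
  (∑ j : Fin g, Real.exp (∑ d, Φ.alpha d j * x d)) + 1

/-- Weight `π_j(x; α)` of the body component `j ≤ g`. -/
def bodyWeight (Φ : Par D g) (x : Fin D → ℝ) (j : Fin g) : ℝ :=
  Real.exp (∑ d, Φ.alpha d j * x d) / weightDenom Φ x

/-- Weight `π_{g+1}(x; α)` of the tail component. -/
def tailWeight (Φ : Par D g) (x : Fin D → ℝ) : ℝ := 1 / weightDenom Φ x

/-- The conditional density `h_Y(y; Φ, x)` of the claim size `y` given `x`, with splicing
threshold `τ`. -/
def compositeDensity (τ : ℝ) (v : Obs D) (Φ : Par D g) : ℝ :=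
  (∑ j : Fin g, bodyWeight Φ v.2 j *
      (gammaDensity (Real.exp (∑ d, Φ.beta d j * v.2 d)) (Φ.phi j) v.1 /
        gammaCdf (Real.exp (∑ d, Φ.beta d j * v.2 d)) (Φ.phi j) τ) *
      (if v.1 ≤ τ then 1 else 0))
  + tailWeight Φ v.2 *
      (lomaxDensity Φ.theta (Real.exp (∑ d, Φ.nu d * v.2 d)) v.1 /
        (1 - lomaxCdf Φ.theta (Real.exp (∑ d, Φ.nu d * v.2 d)) τ)) *
      (if τ < v.1 then 1 else 0)

/-- The logarithm of the density, for one observation. -/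
def logDensity (τ : ℝ) (v : Obs D) (Φ : Par D g) : ℝ := Real.log (compositeDensity τ v Φ)

/-- The law of `V = (Y, x)` under `Φ`: the covariates have law `μX`, and `Y` given `x` has
density `h_Y(·; Φ, x)`. -/
def obsLaw (τ : ℝ) (μX : Measure (Fin D → ℝ)) (Φ : Par D g) : Measure (Obs D) :=
  ((volume : Measure ℝ).prod μX).withDensity fun v => ENNReal.ofReal (compositeDensity τ v Φ)

end Model

/-! ### Partial derivatives and the Fisher information -/

/-- The partial derivative `∂f/∂ψ_i`. -/
def pderiv {ι : Type*} [Fintype ι] [DecidableEq ι] (i : ι) (f : EuclideanSpace ℝ ι → ℝ) :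
    EuclideanSpace ℝ ι → ℝ :=
  fun x => lineDeriv ℝ f x (EuclideanSpace.single i 1)

/-- The vector of first partial derivatives. -/
def gradVec {ι : Type*} [Fintype ι] [DecidableEq ι] (f : EuclideanSpace ℝ ι → ℝ)
    (x : EuclideanSpace ℝ ι) : ι → ℝ :=
  fun i => pderiv i f x

/-- The matrix of second partial derivatives. -/
def hessMatrix {ι : Type*} [Fintype ι] [DecidableEq ι] (f : EuclideanSpace ℝ ι → ℝ)
    (x : EuclideanSpace ℝ ι) : Matrix ι ι ℝ :=
  Matrix.of fun i j => pderiv i (pderiv j f) x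

/-- The Fisher information matrix at `ψ` of the family of log-densities `ℓ v ψ`, where `law` is
the law of an observation `v`. -/
def fisherInfo {ι V : Type*} [Fintype ι] [DecidableEq ι] [MeasurableSpace V] (law : Measure V)
    (ℓ : V → EuclideanSpace ℝ ι → ℝ) (ψ : EuclideanSpace ℝ ι) : Matrix ι ι ℝ :=
  Matrix.of fun i j => ∫ v, pderiv i (ℓ v) ψ * pderiv j (ℓ v) ψ ∂law

/-! ### Regularity conditions on the model -/

/-- Regularity conditions on the family of densities over the parameter space `Θ`, with true
parameter `Φ₀`. The moment and information conditions are required only at `Φ₀`, and the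
domination only in a neighbourhood of `Φ₀`. -/
structure RegularModel {D g : ℕ} (τ : ℝ) (μX : Measure (Fin D → ℝ)) (Θ : Set (Par D g))
    (Φ₀ : Par D g) : Prop where
  common_support : ∀ Φ ∈ Θ, ∀ Φ' ∈ Θ,
    Function.support (fun v : Obs D => compositeDensity τ v Φ) =
      Function.support (fun v : Obs D => compositeDensity τ v Φ')
  identifiable : ∀ Φ ∈ Θ, ∀ Φ' ∈ Θ,
    (∀ᵐ v ∂((volume : Measure ℝ).prod μX), compositeDensity τ v Φ = compositeDensity τ v Φ') →
      ∃ σ : Equiv.Perm (Fin g), Φ' = Φ.permute σ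
  smooth : ∀ᵐ v ∂(obsLaw τ μX Φ₀), ∀ Φ ∈ Θ, ContDiffAt ℝ 3 (compositeDensity τ v) Φ
  score_mean : ∀ i : ParIdx D g, ∫ v, pderiv i (logDensity τ v) Φ₀ ∂(obsLaw τ μX Φ₀) = 0
  information_identity : ∀ i j : ParIdx D g,
    ∫ v, pderiv i (logDensity τ v) Φ₀ * pderiv j (logDensity τ v) Φ₀ ∂(obsLaw τ μX Φ₀) =
      ∫ v, -pderiv i (pderiv j (logDensity τ v)) Φ₀ ∂(obsLaw τ μX Φ₀)
  information_finite : ∀ i j : ParIdx D g,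
    Integrable (fun v => pderiv i (logDensity τ v) Φ₀ * pderiv j (logDensity τ v) Φ₀)
      (obsLaw τ μX Φ₀)
  information_posDef : (fisherInfo (obsLaw τ μX Φ₀) (logDensity τ) Φ₀).PosDef
  dominated : ∃ M : Obs D → ℝ, Integrable M (obsLaw τ μX Φ₀) ∧ ∃ U ∈ 𝓝 Φ₀,
    ∀ᵐ v ∂(obsLaw τ μX Φ₀), ∀ Φ ∈ U, ∀ i j k : ParIdx D g,
      |pderiv i (logDensity τ v) Φ| ≤ M v ∧
      |pderiv i (pderiv j (logDensity τ v)) Φ| ≤ M v ∧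
      |pderiv i (pderiv j (pderiv k (logDensity τ v))) Φ| ≤ M v

/-! ### Stochastic order -/

/-- `X n = O_P(1)`. -/
def BoundedInProb {Ω : Type*} [MeasurableSpace Ω] (P : Measure Ω) (X : ℕ → Ω → ℝ) : Prop :=
  ∀ ε : ℝ≥0∞, 0 < ε → ∃ A : ℝ, ∀ᶠ n in atTop, P {ω | A < |X n ω|} ≤ ε

/-! ### Penalties -/

section Penalty

variable {D g : ℕ}

/-- The argument of a penalty term with coefficient vector `c`: `‖cᵀα‖₂`, `‖cᵀβ‖₂` and `|cᵀν|`
for the three parts of the model (indexed by `0`, `1`, `2`). -/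
def penArg (l : Fin 3) (c : Fin D → ℝ) (Φ : Par D g) : ℝ :=
  match l with
  | 0 => √(∑ j, (∑ d, c d * Φ.alpha d j) ^ 2)
  | 1 => √(∑ j, (∑ d, c d * Φ.beta d j) ^ 2)
  | 2 => |∑ d, c d * Φ.nu d|

/-- The set `Z_l` of penalty terms that vanish at the true parameter. -/
def zeroSet {K : Fin 3 → ℕ} (c : ∀ l, Fin (K l) → Fin D → ℝ) (Φ₀ : Par D g) (l : Fin 3) :
    Set (Fin (K l)) :=
  {k | penArg l (c l k) Φ₀ = 0}

/-- `q` is twice differentiable at `ψ`. -/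
def TwiceDifferentiableAt (q : ℝ → ℝ) (ψ : ℝ) : Prop :=
  (∀ᶠ s in 𝓝 ψ, DifferentiableAt ℝ q s) ∧ DifferentiableAt ℝ (deriv q) ψ

/-- Conditions on the penalty functions.
Here `pen l n ω ψ η` is `p_{ln}(ψ; η)` and `lam l k n ω` is `λ_{lkn}`; both may depend on the
data. The second-derivative condition is uniform over the points at distance `O(n^{-1/2})` from
each nonzero true value. -/
structure RegularPenalty {Ω : Type*} [MeasurableSpace Ω] (P : Measure Ω) {K : Fin 3 → ℕ}
    (c : ∀ l, Fin (K l) → Fin D → ℝ) (pen : Fin 3 → ℕ → Ω → ℝ → ℝ → ℝ)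
    (lam : ∀ l, Fin (K l) → ℕ → Ω → ℝ) (Φ₀ : Par D g) : Prop where
  concave : ∀ l k n ω, ConcaveOn ℝ (Ici 0) fun ψ => pen l n ω ψ (lam l k n ω)
  at_zero : ∀ l k n ω, pen l n ω 0 (lam l k n ω) = 0
  monotone : ∀ l k n ω, MonotoneOn (fun ψ => pen l n ω ψ (lam l k n ω)) (Ici 0)
  twice_diff : ∀ l k n ω, ∃ S : Set ℝ, S.Finite ∧ ∀ ψ, 0 < ψ → ψ ∉ S →
    TwiceDifferentiableAt (fun s => pen l n ω s (lam l k n ω)) ψ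
  second_deriv : ∀ l, ∀ k ∉ zeroSet c Φ₀ l, ∀ C : ℝ, 0 < C → ∀ ε : ℝ, 0 < ε →
    Tendsto (fun n : ℕ => P {ω | ∃ ψ, |ψ - penArg l (c l k) Φ₀| ≤ C / √n ∧
      ¬ (TwiceDifferentiableAt (fun s => pen l n ω s (lam l k n ω)) ψ ∧
        |deriv (deriv fun s => pen l n ω s (lam l k n ω)) ψ| / n ≤ ε)}) atTop (𝓝 0)
  steep_at_zero : ∀ l, ∀ k ∈ zeroSet c Φ₀ l, ∀ A : ℝ,
    Tendsto (fun n : ℕ => P {ω | ∃ ψ, 0 < ψ ∧ ψ ≤ Real.log n / √n ∧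
      DifferentiableAt ℝ (fun s => pen l n ω s (lam l k n ω)) ψ ∧
        deriv (fun s => pen l n ω s (lam l k n ω)) ψ / √n < A}) atTop (𝓝 0)
  first_deriv : ∀ l, ∀ k ∉ zeroSet c Φ₀ l,
    BoundedInProb P fun n ω =>
      deriv (fun s => pen l n ω s (lam l k n ω)) (penArg l (c l k) Φ₀) / √n

/-- The penalty `P_n(Φ)`. -/
def totalPenalty {Ω : Type*} {K : Fin 3 → ℕ} (c : ∀ l, Fin (K l) → Fin D → ℝ)
    (pen : Fin 3 → ℕ → Ω → ℝ → ℝ → ℝ) (lam : ∀ l, Fin (K l) → ℕ → Ω → ℝ) (n : ℕ) (ω : Ω)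
    (Φ : Par D g) : ℝ :=
  ∑ l, ∑ k : Fin (K l), pen l n ω (penArg l (c l k) Φ) (lam l k n ω)

/-- The log-likelihood `L_n(Φ)` of the first `n` observations. -/
def logLik {Ω : Type*} (τ : ℝ) (V : ℕ → Ω → Obs D) (n : ℕ) (ω : Ω) (Φ : Par D g) : ℝ :=
  ∑ i ∈ Finset.range n, logDensity τ (V i ω) Φ

/-- The penalized log-likelihood `F_n(Φ) = L_n(Φ) - P_n(Φ)`. -/
def penLogLik {Ω : Type*} (τ : ℝ) (V : ℕ → Ω → Obs D) {K : Fin 3 → ℕ}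
    (c : ∀ l, Fin (K l) → Fin D → ℝ) (pen : Fin 3 → ℕ → Ω → ℝ → ℝ → ℝ)
    (lam : ∀ l, Fin (K l) → ℕ → Ω → ℝ) (n : ℕ) (ω : Ω) (Φ : Par D g) : ℝ :=
  logLik τ V n ω Φ - totalPenalty c pen lam n ω Φ

end Penalty

/-! ### The linearly transformed parameter space -/

section Transform

variable {D g : ℕ}

/-- `C = (C_red, C_ind)` is an invertible matrix whose first `m` columns are chosen among the
vectors `c_k`, `k ∈ Z`, and span all of these vectors. -/
structure IsReduction {K : ℕ} (c : Fin K → Fin D → ℝ) (Z : Set (Fin K)) (m : ℕ)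
    (C : Matrix (Fin D) (Fin D) ℝ) : Prop where
  le : m ≤ D
  full_rank : IsUnit C.det
  red_mem : ∀ j : Fin D, j.val < m → ∃ k ∈ Z, C.col j = c k
  red_span : ∀ k ∈ Z, c k ∈ Submodule.span ℝ {w | ∃ j : Fin D, j.val < m ∧ w = C.col j}

/-- `(α, β, φ, θ, ν) ↦ (A₁ᵀ α, A₂ᵀ β, φ, θ, A₃ᵀ ν)`. -/
def linTransform (A : Fin 3 → Matrix (Fin D) (Fin D) ℝ) (Φ : Par D g) : Par D g :=
  Par.mk (fun d j => ∑ e, A 0 e d * Φ.alpha e j) (fun d j => ∑ e, A 1 e d * Φ.beta e j)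
    Φ.phi Φ.theta (fun d => ∑ e, A 2 e d * Φ.nu e)

/-- `Φ ↦ Φ*`. -/
def toStar (C : Fin 3 → Matrix (Fin D) (Fin D) ℝ) (Φ : Par D g) : Par D g := linTransform C Φ

/-- `Φ* ↦ Φ`, the inverse of `toStar C` for invertible matrices. -/
def fromStar (C : Fin 3 → Matrix (Fin D) (Fin D) ℝ) (Φs : Par D g) : Par D g :=
  linTransform (fun l => (C l)⁻¹) Φs

/-- The coordinates of `Φ*_red`: the first `m_l` rows of `α*`, `β*` and `ν*`. -/
def IsRed (m : Fin 3 → ℕ) (i : ParIdx D g) : Prop :=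
  match i with
  | Sum.inl (d, _) => d.val < m 0
  | Sum.inr (Sum.inl (d, _)) => d.val < m 1
  | Sum.inr (Sum.inr (Sum.inl _)) => False
  | Sum.inr (Sum.inr (Sum.inr (Sum.inl _))) => False
  | Sum.inr (Sum.inr (Sum.inr (Sum.inr d))) => d.val < m 2

instance (m : Fin 3 → ℕ) : DecidablePred (IsRed (D := D) (g := g) m) :=
  fun _ => Classical.propDecidable _

/-- The coordinates of `Φ*_ind`. -/
abbrev IndIdx (D g : ℕ) (m : Fin 3 → ℕ) : Type := {i : ParIdx D g // ¬ IsRed m i}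

/-- `Φ* ↦ Φ*_ind`. -/
def indPart (m : Fin 3 → ℕ) (Φs : Par D g) : EuclideanSpace ℝ (IndIdx D g m) :=
  WithLp.toLp 2 fun i => Φs i.1

/-- `Φ*_ind ↦ (0, Φ*_ind)`. -/
def withZeroRed (m : Fin 3 → ℕ) (ψ : EuclideanSpace ℝ (IndIdx D g m)) : Par D g :=
  WithLp.toLp 2 fun i => if h : IsRed m i then 0 else ψ ⟨i, h⟩

/-- The log-density of the reduced model, as a function of `Φ*_ind` (with `Φ*_red = 0`). -/
def reducedLogDensity (τ : ℝ) (C : Fin 3 → Matrix (Fin D) (Fin D) ℝ) (m : Fin 3 → ℕ)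
    (v : Obs D) (ψ : EuclideanSpace ℝ (IndIdx D g m)) : ℝ :=
  logDensity τ v (fromStar C (withZeroRed m ψ))

/-- The penalty `P*_n` of the reduced model, as a function of `Φ*_ind` (with `Φ*_red = 0`). -/
def reducedPenalty {Ω : Type*} {K : Fin 3 → ℕ} (c : ∀ l, Fin (K l) → Fin D → ℝ)
    (pen : Fin 3 → ℕ → Ω → ℝ → ℝ → ℝ) (lam : ∀ l, Fin (K l) → ℕ → Ω → ℝ)
    (C : Fin 3 → Matrix (Fin D) (Fin D) ℝ) (m : Fin 3 → ℕ) (n : ℕ) (ω : Ω)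
    (ψ : EuclideanSpace ℝ (IndIdx D g m)) : ℝ :=
  totalPenalty c pen lam n ω (fromStar C (withZeroRed m ψ))

end Transform

end

/-! By √n-consistency everything takes place in a ball of radius a/√n about the true parameter,
where a is a constant fixed after an event of small probability has been discarded. There the score
is O_P(√n): at `Φ₀` by Chebyshev, and nearby because its derivatives sum to O_P(n) under the
integrable bound `M`. Likewise q' is O_P(√n) for each penalty term whose true argument is nonzero.
Hence the log-likelihood and these terms are Lipschitz with constant O_P(√n). A term whose true
argument is zero has slope exceeding every fixed multiple of √n.

Part (a) compares values along one direction. The invertible transformation supplies, for each Φ, a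
vector w that shares the arguments to be killed (`penMap` agrees on w and Φ) and whose norm is at
most a constant times the sum d of these arguments (`exists_scaling_direction`). Moving from Φ to Φ
- t w lowers the steep terms by at least t·a·d, with a any chosen multiple of √n, and changes the
rest by at most O(√n)·t·d. A local maximizer therefore has d = 0 (`sum_norm_eq_zero_of_isLocalMax`,
`eventually_map_eq_zero`). Concavity makes the slope bound usable across kinks, and no
differentiability at zero is needed.

For part (b), on the event of part (a) the estimator lies in the subspace Φ*_red = 0 and is a local
maximizer there. On this subspace the steep terms are constant and the others are differentiable
near the truth, so the likelihood equations hold (`eventually_score_eq`). They are expanded about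
the truth: the Taylor remainder divided by √n vanishes by the third-derivative bound, the averaged
second derivatives tend to minus the information, the penalty gradient varies by o_P(√n), and its
Hessian is o_P(n). Hence the statistic differs from the normalized score by o_P(1)
(`tendsto_expansion`); the central limit theorem and Slutsky's lemma conclude. As the Hessian term
is negligible, its sign in the statement is immaterial. -/

noncomputable section

/-! ### Events of probability tending to one, and O_P(1) -/

section HighProbability

variable {Ω : Type*} [MeasurableSpace Ω] {P : Measure Ω}

/-- The filter of families of events whose probability tends to one. -/
def whp (P : Measure Ω) : Filter (ℕ × Ω) where
  sets := {A | Tendsto (fun n => P {ω | (n, ω) ∉ A}) atTop (𝓝 0)}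
  univ_sets := by simp
  sets_of_superset := by
    intro A B hA hAB
    exact tendsto_of_tendsto_of_tendsto_of_le_of_le tendsto_const_nhds hA (fun _ => zero_le)
      fun n => measure_mono fun ω hω h => hω (hAB h)
  inter_sets := by
    intro A B hA hB
    refine tendsto_of_tendsto_of_tendsto_of_le_of_le (g := fun _ => 0) tendsto_const_nhds
      (by simpa using Tendsto.add hA hB) (fun _ => zero_le) fun n => ?_
    refine le_trans (measure_mono fun ω hω => ?_) (measure_union_le _ _)
    by_cases h : (n, ω) ∈ A
    · exact Or.inr fun h' => hω ⟨h, h'⟩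
    · exact Or.inl h

lemma eventually_whp_iff (Q : ℕ → Ω → Prop) :
    (∀ᶠ p in whp P, Q p.1 p.2) ↔ Tendsto (fun n => P {ω | ¬ Q n ω}) atTop (𝓝 0) := Iff.rfl

lemma tendsto_fst_whp (P : Measure Ω) : Tendsto Prod.fst (whp P) atTop := by
  intro A hA
  refine (eventually_whp_iff fun n _ => n ∈ A).2 (tendsto_const_nhds.congr' ?_)
  filter_upwards [hA] with n hn
  have : n ∈ A := hn
  simp [this]

lemma eventually_whp_of_ae {Q : ℕ → Ω → Prop} (h : ∀ n, ∀ᵐ ω ∂P, Q n ω) :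
    ∀ᶠ p in whp P, Q p.1 p.2 :=
  (eventually_whp_iff Q).2 (tendsto_const_nhds.congr fun n => (ae_iff.1 (h n)).symm)

/-- A random sequence that is O_P(1) may be treated as bounded by a deterministic constant: the
exceptional event costs an arbitrarily small probability. Each stochastic bound used later is turned
into a constant in this way. -/
lemma eventually_whp_of_bounded {X : ℕ → Ω → ℝ} (hX : BoundedInProb P X) {Q : ℕ → Ω → Prop}
    (h : ∀ A, ∀ᶠ p in whp P, |X p.1 p.2| ≤ A → Q p.1 p.2) : ∀ᶠ p in whp P, Q p.1 p.2 := by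
  rw [eventually_whp_iff, ENNReal.tendsto_nhds_zero]
  intro ε hε
  obtain ⟨A, hA⟩ := hX (ε / 2) (ENNReal.half_pos hε.ne')
  have h2 := ENNReal.tendsto_nhds_zero.1 ((eventually_whp_iff fun n ω => |X n ω| ≤ A → Q n ω).1 (h A)) (ε / 2)
    (ENNReal.half_pos hε.ne')
  filter_upwards [hA, h2] with n h1 h2
  calc P {ω | ¬ Q n ω}
      ≤ P ({ω | A < |X n ω|} ∪ {ω | ¬ (|X n ω| ≤ A → Q n ω)}) := by
        refine measure_mono fun ω hω => ?_
        by_cases hx : |X n ω| ≤ A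
        · exact Or.inr fun h => hω (h hx)
        · exact Or.inl (not_le.1 hx)
    _ ≤ ε / 2 + ε / 2 := (measure_union_le _ _).trans (add_le_add h1 h2)
    _ = ε := ENNReal.add_halves ε

/-- The filter only controls the outer measure of the complement; measurability is what converts
this into a limit for the event itself. -/
lemma tendsto_measure_one_of_whp [IsProbabilityMeasure P] {Q : ℕ → Ω → Prop}
    (hQ : ∀ n, MeasurableSet {ω | Q n ω}) (h : ∀ᶠ p in whp P, Q p.1 p.2) :
    Tendsto (fun n => P {ω | Q n ω}) atTop (𝓝 1) := by
  have h1 := (eventually_whp_iff Q).1 h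
  have h2 : ∀ n, P {ω | Q n ω} = 1 - P {ω | ¬ Q n ω} := fun n => by
    have := prob_compl_eq_one_sub (μ := P) (hQ n).compl
    rw [compl_compl] at this
    exact this
  simp_rw [h2]
  simpa using ENNReal.Tendsto.sub tendsto_const_nhds h1 (Or.inl ENNReal.one_ne_top)

lemma tendsto_whp_of_tendstoInMeasure {X : ℕ → Ω → ℝ} {a : ℝ}
    (h : TendstoInMeasure P X atTop fun _ => a) :
    Tendsto (fun p : ℕ × Ω => X p.1 p.2) (whp P) (𝓝 a) := by
  rw [Metric.tendsto_nhds]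
  intro ε hε
  refine (eventually_whp_iff fun n ω => dist (X n ω) a < ε).2 ?_
  simpa using tendstoInMeasure_iff_dist.1 h ε hε

lemma tendstoInMeasure_of_tendsto_whp {E : Type*} [SeminormedAddCommGroup E] {X : ℕ → Ω → E}
    (h : ∀ ε : ℝ, 0 < ε → ∀ᶠ p in whp P, ‖X p.1 p.2‖ < ε) :
    TendstoInMeasure P X atTop 0 := by
  rw [tendstoInMeasure_iff_norm]
  intro ε hε
  simpa using (eventually_whp_iff fun n ω => ‖X n ω‖ < ε).1 (h ε hε)

/-- Markov's inequality. -/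
lemma boundedInProb_of_lintegral_le {X : ℕ → Ω → ℝ} {B : ℝ≥0∞} (hB : B ≠ ∞)
    (hX : ∀ n, AEMeasurable (X n) P) (h : ∀ n, ∫⁻ ω, ‖X n ω‖ₑ ∂P ≤ B) : BoundedInProb P X := by
  intro ε hε
  by_cases hεt : ε = ∞
  · exact ⟨0, Eventually.of_forall fun n => by simp [hεt]⟩
  have hA : B / ε ≠ ∞ := ENNReal.div_ne_top hB hε.ne'
  -- The added 1 keeps the level positive when `B = 0`.
  refine ⟨(B / ε).toReal + 1, Eventually.of_forall fun n => ?_⟩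
  have h0 : B / ε + 1 ≠ 0 := by simp
  have h1 : B / ε + 1 ≠ ∞ := by simp [hA]
  calc P {ω | (B / ε).toReal + 1 < |X n ω|} ≤ P {ω | B / ε + 1 ≤ ‖X n ω‖ₑ} := by
        refine measure_mono fun ω hω => ?_
        have : B / ε + 1 = ENNReal.ofReal ((B / ε).toReal + 1) := by
          rw [ENNReal.ofReal_add ENNReal.toReal_nonneg zero_le_one, ENNReal.ofReal_toReal hA]
          simp
        simp only [mem_ofPred_eq] at hω ⊢
        rw [this, Real.enorm_eq_ofReal_abs]
        exact ENNReal.ofReal_le_ofReal hω.le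
    _ ≤ (∫⁻ ω, ‖X n ω‖ₑ ∂P) / (B / ε + 1) := meas_ge_le_lintegral_div (hX n).enorm h0 h1
    _ ≤ B / (B / ε + 1) := ENNReal.div_le_div_right (h n) _
    _ ≤ ε := by
        refine ENNReal.div_le_of_le_mul' ?_
        rw [add_mul, one_mul, ENNReal.div_mul_cancel hε.ne' hεt]
        exact le_self_add

end HighProbability

/-! ### Limit theorems for an i.i.d. sample -/

section IndependentSample

variable {Ω 𝓥 : Type*} [MeasurableSpace Ω] [MeasurableSpace 𝓥] {P : Measure Ω}
  {V : ℕ → Ω → 𝓥} {law : Measure 𝓥}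

lemma identDistrib_sample (hV : ∀ i, Measurable (V i)) (hlaw : ∀ i, P.map (V i) = law)
    {β : Type*} [MeasurableSpace β] {f : 𝓥 → β} (hf : Measurable f) (i : ℕ) :
    IdentDistrib (fun ω => f (V i ω)) (fun ω => f (V 0 ω)) P P :=
  (IdentDistrib.mk (hV i).aemeasurable (hV 0).aemeasurable
    ((hlaw i).trans (hlaw 0).symm)).comp hf

lemma ae_sample (hV : ∀ i, Measurable (V i)) (hlaw : ∀ i, P.map (V i) = law)
    {p : 𝓥 → Prop} (h : ∀ᵐ v ∂law, p v) : ∀ᵐ ω ∂P, ∀ i, p (V i ω) := by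
  refine ae_all_iff.2 fun i => ?_
  rw [← hlaw i] at h
  exact ae_of_ae_map (hV i).aemeasurable h

/-- Weak law of large numbers. -/
lemma tendsto_whp_average [IsProbabilityMeasure P] (hV : ∀ i, Measurable (V i)) (hind : iIndepFun V P)
    (hlaw : ∀ i, P.map (V i) = law) {f : 𝓥 → ℝ} (hf : Integrable f law) :
    Tendsto (fun p : ℕ × Ω => (∑ k ∈ Finset.range p.1, f (V k p.2)) / p.1) (whp P)
      (𝓝 (∫ v, f v ∂law)) := by
  -- `f` is only a.e. measurable, whereas composition with the sample needs a measurable function;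
  -- the two agree along almost every sample.
  set F := hf.1.mk f with hF
  have hFm : Measurable F := hf.1.stronglyMeasurable_mk.measurable
  have hfF : f =ᵐ[law] F := hf.1.ae_eq_mk
  have hFi : Integrable F law := hf.congr hfF
  have hslln := strong_law_ae_real (fun i ω => F (V i ω)) (μ := P)
    (by
      have := hFi
      rw [← hlaw 0] at this
      exact this.comp_measurable (hV 0))
    (fun i j hij => (hind.indepFun hij).comp hFm hFm)
    (identDistrib_sample hV hlaw hFm)
  have hint : ∫ ω, F (V 0 ω) ∂P = ∫ v, f v ∂law := by
    rw [integral_congr_ae hfF, ← hlaw 0, integral_map (hV 0).aemeasurable]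
    exact hFm.aestronglyMeasurable
  rw [hint] at hslln
  refine tendsto_whp_of_tendstoInMeasure
    (X := fun n ω => (∑ k ∈ Finset.range n, f (V k ω)) / (n : ℝ)) ?_
  have hlim : TendstoInMeasure P (fun (n : ℕ) ω => (∑ k ∈ Finset.range n, F (V k ω)) / (n : ℝ))
      atTop fun _ => ∫ v, f v ∂law := by
    refine tendstoInMeasure_of_tendsto_ae (fun n => ?_) hslln
    refine Measurable.aestronglyMeasurable ?_
    exact (Finset.measurable_sum _ fun k _ => hFm.comp (hV k)).div_const _
  refine hlim.congr' (Eventually.of_forall fun n => ?_) (ae_eq_refl _)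
  filter_upwards [ae_sample hV hlaw hfF] with ω hω
  simp [hω]

/-- The averages are bounded in L¹ by the L¹ norm of `f`, so Markov's inequality suffices and
independence plays no role. -/
lemma boundedInProb_average (hV : ∀ i, Measurable (V i))
    (hlaw : ∀ i, P.map (V i) = law) {f : 𝓥 → ℝ} (hf : Integrable f law) :
    BoundedInProb P fun n ω => (∑ k ∈ Finset.range n, f (V k ω)) / n := by
  have hfk : ∀ k, Integrable (fun ω => f (V k ω)) P := fun k => by
    have := hf
    rw [← hlaw k] at this
    exact this.comp_measurable (hV k)
  refine boundedInProb_of_lintegral_le (B := ∫⁻ v, ‖f v‖ₑ ∂law) hf.2.ne (fun n => ?_) fun n => ?_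
  · exact (Finset.aemeasurable_fun_sum _ fun k _ => (hfk k).aemeasurable).div_const _
  · have h1 : ∀ ω, ‖(∑ k ∈ Finset.range n, f (V k ω)) / (n : ℝ)‖ₑ ≤
        (∑ k ∈ Finset.range n, ‖f (V k ω)‖ₑ) * ‖(n : ℝ)⁻¹‖ₑ := fun ω => by
      rw [div_eq_mul_inv, enorm_mul]
      gcongr
      exact enorm_sum_le _ _
    refine (lintegral_mono h1).trans ?_
    rw [lintegral_mul_const'' _
      (Finset.aemeasurable_fun_sum _ fun k _ => (hfk k).aemeasurable.enorm),
      lintegral_finsetSum' _ fun k _ => (hfk k).aemeasurable.enorm]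
    have h2 : ∀ k, ∫⁻ ω, ‖f (V k ω)‖ₑ ∂P = ∫⁻ v, ‖f v‖ₑ ∂law := fun k => by
      have hm : AEMeasurable f (P.map (V k)) := (hlaw k).symm ▸ hf.aemeasurable
      rw [← hlaw k, lintegral_map' hm.enorm (hV k).aemeasurable]
    simp only [h2, Finset.sum_const, Finset.card_range, nsmul_eq_mul]
    rcases Nat.eq_zero_or_pos n with rfl | hn
    · simp
    · rw [mul_right_comm]
      have : (n : ℝ≥0∞) * ‖(n : ℝ)⁻¹‖ₑ = 1 := by
        rw [Real.enorm_eq_ofReal (by positivity), ENNReal.ofReal_inv_of_pos (by positivity)]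
        simp only [ENNReal.ofReal_natCast]
        exact ENNReal.mul_inv_cancel (by simpa using hn.ne') (by simp)
      rw [this, one_mul]

/-- Chebyshev's inequality: by pairwise independence the normalized sums have variance at most that
of one observation. -/
lemma boundedInProb_inv_sqrt_mul_sum [IsProbabilityMeasure P] (hV : ∀ i, Measurable (V i))
    (hind : iIndepFun V P)
    (hlaw : ∀ i, P.map (V i) = law) {f : 𝓥 → ℝ} (hf : MemLp f 2 law) (hf0 : ∫ v, f v ∂law = 0) :
    BoundedInProb P fun n ω => (√n)⁻¹ * ∑ k ∈ Finset.range n, f (V k ω) := by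
  set F := hf.1.mk f with hF
  have hFm : Measurable F := hf.1.stronglyMeasurable_mk.measurable
  have hfF : f =ᵐ[law] F := hf.1.ae_eq_mk
  have hF2 : ∀ k, MemLp (fun ω => F (V k ω)) 2 P := fun k => by
    have h : MemLp F 2 (P.map (V k)) := by rw [hlaw k]; exact (memLp_congr_ae hfF).1 hf
    exact h.comp_of_map (hV k).aemeasurable
  have hF0 : ∀ k, ∫ ω, F (V k ω) ∂P = 0 := fun k => by
    rw [← integral_map (hV k).aemeasurable hFm.aestronglyMeasurable, hlaw k,
      ← integral_congr_ae hfF, hf0]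
  set X : ℕ → Ω → ℝ := fun n ω => (√n)⁻¹ * ∑ k ∈ Finset.range n, F (V k ω) with hX
  have hX2 : ∀ n, MemLp (X n) 2 P := fun n =>
    (memLp_finsetSum _ fun k _ => hF2 k).const_mul _
  have hX0 : ∀ n, ∫ ω, X n ω ∂P = 0 := fun n => by
    simp only [hX]
    rw [integral_const_mul, integral_finsetSum _ fun k _ => (hF2 k).integrable one_le_two]
    simp [hF0]
  set σ := Var[fun ω => F (V 0 ω); P] with hσ
  have hXv : ∀ n, Var[X n; P] ≤ σ := fun n => by
    have h1 : X n = fun ω => (√n)⁻¹ * (∑ k ∈ Finset.range n, fun ω => F (V k ω)) ω := by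
      funext ω
      simp [hX]
    rw [h1, variance_const_mul, IndepFun.variance_sum (fun k _ => hF2 k)
      fun i _ j _ hij => (hind.indepFun hij).comp hFm hFm]
    simp only [fun k => (identDistrib_sample hV hlaw hFm k).variance_eq, Finset.sum_const,
      Finset.card_range, nsmul_eq_mul]
    rcases Nat.eq_zero_or_pos n with rfl | hn
    · simp [hσ, variance_nonneg]
    · have : (0 : ℝ) < n := by exact_mod_cast hn
      rw [inv_pow, Real.sq_sqrt this.le, ← mul_assoc, inv_mul_cancel₀ this.ne', one_mul]
  have hfX : ∀ n : ℕ, (fun ω => (√n)⁻¹ * ∑ k ∈ Finset.range n, f (V k ω)) =ᵐ[P] X n := fun n => by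
    filter_upwards [ae_sample hV hlaw hfF] with ω hω
    simp [hX, hω]
  intro ε hε
  -- `ε` may be infinite, while the variance bound is real; a positive real below it is enough.
  obtain ⟨e, he0, he⟩ : ∃ e : ℝ, 0 < e ∧ ENNReal.ofReal e ≤ ε := by
    obtain ⟨r, hr0, hr⟩ := ENNReal.lt_iff_exists_nnreal_btwn.1 hε
    exact ⟨r, by exact_mod_cast hr0, by simpa using hr.le⟩
  have hσ0 : 0 ≤ σ := variance_nonneg _ _
  refine ⟨√(σ / e) + 1, Eventually.of_forall fun n => ?_⟩
  have hA : 0 < √(σ / e) + 1 := by positivity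
  have h2 := meas_ge_le_variance_div_sq (hX2 n) hA
  simp only [hX0 n, sub_zero] at h2
  calc P {ω | √(σ / e) + 1 < |(√n)⁻¹ * ∑ k ∈ Finset.range n, f (V k ω)|}
      ≤ P {ω | √(σ / e) + 1 ≤ |X n ω|} := by
        refine measure_mono_ae ?_
        filter_upwards [hfX n] with ω hω h
        change _ < _ at h
        rw [hω] at h
        exact h.le
    _ ≤ ENNReal.ofReal e := by
        refine h2.trans (ENNReal.ofReal_le_ofReal ?_)
        rw [div_le_iff₀ (by positivity)]
        have h3 : σ / e ≤ (√(σ / e) + 1) ^ 2 := by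
          nlinarith [Real.sq_sqrt (div_nonneg hσ0 he0.le), Real.sqrt_nonneg (σ / e)]
        calc Var[X n; P] ≤ σ := hXv n
          _ = e * (σ / e) := by field_simp
          _ ≤ _ := by gcongr
    _ ≤ ε := he

/-- The quadratic form of a Gram matrix is a second moment. This gives positive semidefiniteness and
identifies the Gaussian exponent in the central limit theorem. -/
lemma dotProduct_mulVec_of_integral_mul {ι : Type*} [Fintype ι] {f : ι → 𝓥 → ℝ}
    (hf : ∀ i, MemLp (f i) 2 law) (t : ι → ℝ) :
    t ⬝ᵥ (Matrix.of fun i j => ∫ v, f i v * f j v ∂law).mulVec t =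
      ∫ v, (∑ i, t i * f i v) ^ 2 ∂law := by
  have hi : ∀ i j, Integrable (fun v => f i v * f j v) law := fun i j => (hf i).integrable_mul (hf j)
  have h : ∀ v, (∑ i, t i * f i v) ^ 2 = ∑ i, ∑ j, t i * (t j * (f i v * f j v)) := fun v => by
    rw [sq, Finset.sum_mul_sum]
    refine Finset.sum_congr rfl fun i _ => Finset.sum_congr rfl fun j _ => by ring
  simp_rw [h]
  rw [integral_finsetSum _ fun i _ => integrable_finsetSum _ fun j _ =>
    ((hi i j).const_mul _).const_mul _]
  simp only [dotProduct, Matrix.mulVec, Matrix.of_apply, Finset.mul_sum]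
  refine Finset.sum_congr rfl fun i _ => ?_
  rw [integral_finsetSum _ fun j _ => ((hi i j).const_mul _).const_mul _]
  refine Finset.sum_congr rfl fun j _ => ?_
  rw [integral_const_mul, integral_const_mul]
  ring

lemma posSemidef_of_integral_mul {ι : Type*} [Fintype ι] {f : ι → 𝓥 → ℝ}
    (hf : ∀ i, MemLp (f i) 2 law) :
    (Matrix.of fun i j => ∫ v, f i v * f j v ∂law).PosSemidef := by
  refine Matrix.PosSemidef.of_dotProduct_mulVec_nonneg ?_ fun t => ?_
  · ext i j
    simp [mul_comm]
  · rw [star_trivial, dotProduct_mulVec_of_integral_mul hf]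
    exact integral_nonneg fun v => sq_nonneg _

/-- Central limit theorem in several dimensions. -/
lemma tendstoInDistribution_inv_sqrt_mul_sum_pi [IsProbabilityMeasure P]
    (hV : ∀ i, Measurable (V i)) (hind : iIndepFun V P) (hlaw : ∀ i, P.map (V i) = law)
    {ι : Type*} [Fintype ι] [DecidableEq ι] {f : ι → 𝓥 → ℝ} (hf : ∀ i, MemLp (f i) 2 law)
    (hf0 : ∀ i, ∫ v, f i v ∂law = 0) :
    TendstoInDistribution
      (fun (n : ℕ) ω => WithLp.toLp 2 fun i => (√n)⁻¹ * ∑ k ∈ Finset.range n, f i (V k ω))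
      atTop (id : EuclideanSpace ℝ ι → _) (fun _ => P)
      (multivariateGaussian 0 (Matrix.of fun i j => ∫ v, f i v * f j v ∂law)) := by
  set F : ι → 𝓥 → ℝ := fun i => (hf i).1.mk (f i) with hF
  have hFm : ∀ i, Measurable (F i) := fun i => (hf i).1.stronglyMeasurable_mk.measurable
  have hfF : ∀ i, f i =ᵐ[law] F i := fun i => (hf i).1.ae_eq_mk
  have hmeas : ∀ n : ℕ, Measurable fun ω => (WithLp.toLp 2 fun i => (√n)⁻¹ *
      ∑ k ∈ Finset.range n, F i (V k ω) : EuclideanSpace ℝ ι) := fun n =>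
    (WithLp.measurable_toLp 2 _).comp <| measurable_pi_lambda _ fun i =>
      (Finset.measurable_sum _ fun k _ => (hFm i).comp (hV k)).const_mul _
  suffices h : TendstoInDistribution
      (fun (n : ℕ) ω => WithLp.toLp 2 fun i => (√n)⁻¹ * ∑ k ∈ Finset.range n, F i (V k ω))
      atTop (id : EuclideanSpace ℝ ι → _) (fun _ => P)
      (multivariateGaussian 0 (Matrix.of fun i j => ∫ v, f i v * f j v ∂law)) by
    refine h.congr (fun n => ?_) (ae_eq_refl _)
    filter_upwards [ae_sample hV hlaw (ae_all_iff.2 hfF)] with ω hω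
    simp [hω]
  refine ⟨fun n => (hmeas n).aemeasurable, aemeasurable_id, ?_⟩
  refine ProbabilityMeasure.tendsto_iff_tendsto_charFun.2 fun t => ?_
  -- Cramér–Wold: for fixed `t` the vector characteristic function at `t` is that of the scalar sums
  -- of `W` at 1, so the one-dimensional theorem applies.
  set W : 𝓥 → ℝ := fun v => ∑ i, t i * F i v with hW
  have hWm : Measurable W := Finset.measurable_sum _ fun i _ => (hFm i).const_mul _
  have hfW : (fun v => ∑ i, t i * f i v) =ᵐ[law] W := by
    filter_upwards [ae_all_iff.2 hfF] with v hv
    simp [hW, hv]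
  have hW2 : MemLp W 2 law :=
    (memLp_congr_ae hfW).1 (memLp_finsetSum _ fun i _ => (hf i).const_mul _)
  have hWP : MemLp (fun ω => W (V 0 ω)) 2 P := by
    rw [← hlaw 0] at hW2
    exact hW2.comp_of_map (hV 0).aemeasurable
  have hW0 : ∫ ω, W (V 0 ω) ∂P = 0 := by
    rw [← integral_map (hV 0).aemeasurable hWm.aestronglyMeasurable, hlaw 0,
      ← integral_congr_ae hfW]
    have : IsProbabilityMeasure law := by
      rw [← hlaw 0]; exact Measure.isProbabilityMeasure_map (hV 0).aemeasurable
    rw [integral_finsetSum _ fun i _ => ((hf i).integrable one_le_two).const_mul _]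
    simp [integral_const_mul, hf0]
  have hWv : Var[fun ω => W (V 0 ω); P] = ∫ v, (∑ i, t i * f i v) ^ 2 ∂law := by
    rw [variance_of_integral_eq_zero hWP.aemeasurable hW0, ← integral_map (f := fun v => W v ^ 2)
      (hV 0).aemeasurable (hWm.pow_const 2).aestronglyMeasurable, hlaw 0]
    refine integral_congr_ae ?_
    filter_upwards [hfW] with v hv
    rw [← hv]
  have hclt := tendstoInDistribution_inv_sqrt_mul_sum_sub (P := P)
    (P' := gaussianReal 0 Var[fun ω => W (V 0 ω); P].toNNReal) (Y := id)
    (X := fun k ω => W (V k ω)) HasLaw.id hWP (hind.comp (fun _ => W) fun _ => hWm)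
    (identDistrib_sample hV hlaw hWm)
  have hlim := ProbabilityMeasure.tendsto_iff_tendsto_charFun.1 hclt.tendsto 1
  convert hlim using 1
  · funext n
    simp only [ProbabilityMeasure.coe_mk, charFun_apply]
    rw [integral_map (hmeas n).aemeasurable (by fun_prop), integral_map
      (hclt.forall_aemeasurable n) (by fun_prop)]
    refine integral_congr_ae (Eventually.of_forall fun ω => ?_)
    simp only [hW0, mul_zero, sub_zero]
    congr 3
    simp only [PiLp.inner_apply, RCLike.inner_apply, conj_trivial, hW, Finset.mul_sum]
    rw [Finset.sum_comm]
    simp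
    refine Finset.sum_congr rfl fun i _ => Finset.sum_congr rfl fun k _ => by ring
  · simp only [ProbabilityMeasure.coe_mk, Measure.map_id]
    rw [charFun_multivariateGaussian (posSemidef_of_integral_mul hf), charFun_gaussianReal,
      dotProduct_mulVec_of_integral_mul hf, hWv]
    have h0 : 0 ≤ ∫ v, (∑ i, t i * f i v) ^ 2 ∂law := integral_nonneg fun v => sq_nonneg _
    simp [h0]

end IndependentSample

/-! ### Partial derivatives and mean value estimates -/

section PartialDerivatives

variable {ι : Type*} [Fintype ι] [DecidableEq ι] {f : EuclideanSpace ℝ ι → ℝ}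
  {x : EuclideanSpace ℝ ι}

lemma pderiv_eq_fderiv (hf : DifferentiableAt ℝ f x) (i : ι) :
    pderiv i f x = fderiv ℝ f x (EuclideanSpace.single i 1) :=
  hf.lineDeriv_eq_fderiv

lemma clm_apply_eq_sum (A : EuclideanSpace ℝ ι →L[ℝ] ℝ) (w : EuclideanSpace ℝ ι) :
    A w = ∑ i, w i * A (EuclideanSpace.single i 1) := by
  conv_lhs => rw [← (EuclideanSpace.basisFun ι ℝ).sum_repr w]
  simp

lemma fderiv_apply_eq_sum_pderiv (hf : DifferentiableAt ℝ f x) (w : EuclideanSpace ℝ ι) :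
    fderiv ℝ f x w = ∑ i, w i * pderiv i f x := by
  rw [clm_apply_eq_sum]
  simp_rw [pderiv_eq_fderiv hf]

/-- A line derivative agrees with the Fréchet derivative only where the latter exists, so smoothness
is used on a whole neighbourhood. -/
lemma ContDiffAt.pderiv {n : ℕ} (hf : ContDiffAt ℝ (n + 1 : ℕ) f x) (i : ι) :
    ContDiffAt ℝ n (_root_.pderiv i f) x := by
  have h1 : ContDiffAt ℝ n (fun y => fderiv ℝ f y (EuclideanSpace.single i 1)) x :=
    (hf.fderiv_right (m := n) (by norm_cast)).clm_apply contDiffAt_const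
  refine h1.congr_of_eventuallyEq ?_
  have h2 : ∀ᶠ y in 𝓝 x, ContDiffAt ℝ (n + 1 : ℕ) f y := hf.eventually (by simp)
  filter_upwards [h2] with y hy
  exact pderiv_eq_fderiv (hy.differentiableAt (by simp)) i

lemma norm_clm_le_card_mul {A : EuclideanSpace ℝ ι →L[ℝ] ℝ} {M : ℝ} (hM : 0 ≤ M)
    (h : ∀ i, |A (EuclideanSpace.single i 1)| ≤ M) : ‖A‖ ≤ Fintype.card ι * M := by
  refine A.opNorm_le_bound (by positivity) fun w => ?_
  rw [clm_apply_eq_sum, Real.norm_eq_abs]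
  calc |∑ i, w i * A (EuclideanSpace.single i 1)|
      ≤ ∑ i, |w i * A (EuclideanSpace.single i 1)| := Finset.abs_sum_le_sum_abs _ _
    _ ≤ ∑ _i : ι, ‖w‖ * M := by
        refine Finset.sum_le_sum fun i _ => ?_
        rw [abs_mul]
        exact mul_le_mul (PiLp.norm_apply_le w i) (h i) (abs_nonneg _) (norm_nonneg _)
    _ = Fintype.card ι * M * ‖w‖ := by simp; ring

lemma abs_sub_le_of_pderiv_le {s : Set (EuclideanSpace ℝ ι)} (hs : Convex ℝ s)
    (hf : ∀ z ∈ s, DifferentiableAt ℝ f z) {M : ℝ} (hM : 0 ≤ M)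
    (h : ∀ z ∈ s, ∀ i, |pderiv i f z| ≤ M) {y : EuclideanSpace ℝ ι} (hx : x ∈ s) (hy : y ∈ s) :
    |f y - f x| ≤ Fintype.card ι * M * ‖y - x‖ :=
  hs.norm_image_sub_le_of_norm_fderiv_le hf
    (fun z hz => norm_clm_le_card_mul hM fun i => by rw [← pderiv_eq_fderiv (hf z hz)]; exact h z hz i)
    hx hy

/-- The mean value inequality is used twice: for the partial derivatives, to bound the variation of
`fderiv` along the segment, and then for `f` minus its linearization. The constant is not sharp, as
only its order matters. -/
lemma abs_taylor_one_le {s : Set (EuclideanSpace ℝ ι)} (hs : Convex ℝ s)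
    (hf : ∀ z ∈ s, ContDiffAt ℝ 2 f z) {M : ℝ} (hM : 0 ≤ M)
    (h : ∀ z ∈ s, ∀ i j, |pderiv i (pderiv j f) z| ≤ M) {y : EuclideanSpace ℝ ι}
    (hx : x ∈ s) (hy : y ∈ s) :
    |f y - f x - ∑ i, (y - x) i * pderiv i f x| ≤
      Fintype.card ι * (Fintype.card ι * M) * ‖y - x‖ ^ 2 := by
  have hfd : ∀ z ∈ s, DifferentiableAt ℝ f z := fun z hz => (hf z hz).differentiableAt (by simp)
  have hseg : segment ℝ x y ⊆ s := hs.segment_subset hx hy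
  rw [← fderiv_apply_eq_sum_pderiv (hfd x hx), sq, ← mul_assoc]
  refine (convex_segment x y).norm_image_sub_le_of_norm_hasFDerivWithin_le'
    (f' := fderiv ℝ f) (fun z hz => (hfd z (hseg hz)).hasFDerivAt.hasFDerivWithinAt)
    (fun z hz => ?_) (left_mem_segment ℝ x y) (right_mem_segment ℝ x y)
  rw [mul_assoc]
  refine norm_clm_le_card_mul (by positivity) fun i => ?_
  rw [sub_apply, ← pderiv_eq_fderiv (hfd z (hseg hz)),
    ← pderiv_eq_fderiv (hfd x hx)]
  have h1 : ∀ z ∈ s, ContDiffAt ℝ 1 (pderiv i f) z := fun z hz => by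
    exact_mod_cast ContDiffAt.pderiv (n := 1) (by exact_mod_cast hf z hz) i
  refine (abs_sub_le_of_pderiv_le hs (fun z hz => (h1 z hz).differentiableAt (by simp)) hM
    (fun z hz j => h z hz j i) hx (hseg hz)).trans ?_
  gcongr
  obtain ⟨a, b, ha, hb, hab, rfl⟩ := hz
  have : a • x + b • y - x = b • (y - x) := by
    rw [← sub_eq_iff_eq_add.2 hab.symm]; module
  rw [this, norm_smul, Real.norm_of_nonneg hb]
  exact mul_le_of_le_one_left (norm_nonneg _) (by linarith)

/-- A partial derivative is an a.e. limit of difference quotients, each measurable in the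
observation. -/
lemma aemeasurable_pderiv {𝓥 : Type*} [MeasurableSpace 𝓥] {law : Measure 𝓥}
    {F : 𝓥 → EuclideanSpace ℝ ι → ℝ} {r : ℝ} (hr : 0 < r)
    (hF : ∀ y ∈ Metric.ball x r, AEMeasurable (fun v => F v y) law)
    (hd : ∀ᵐ v ∂law, DifferentiableAt ℝ (F v) x) (i : ι) :
    AEMeasurable (fun v => pderiv i (F v) x) law := by
  -- Steps of at most `r / 2` keep the quotients inside the ball where measurability is known.
  set t : ℕ → ℝ := fun n => r / 2 / (n + 1) with ht
  have ht0 : ∀ n, 0 < t n := fun n => by positivity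
  have htr : ∀ n, t n ≤ r / 2 := fun n => div_le_self (by positivity) (by simp)
  have htl : Tendsto t atTop (𝓝[≠] 0) := by
    refine tendsto_nhdsWithin_iff.2 ⟨?_, Eventually.of_forall fun n => (ht0 n).ne'⟩
    simpa [ht, div_eq_mul_inv] using
      (tendsto_one_div_add_atTop_nhds_zero_nat (𝕜 := ℝ)).const_mul (r / 2)
  refine aemeasurable_of_tendsto_metrizable_ae atTop
    (f := fun n v => (t n)⁻¹ • (F v (x + t n • EuclideanSpace.single i 1) - F v x))
    (fun n => ?_) ?_
  · refine ((hF _ ?_).sub (hF x (Metric.mem_ball_self hr))).const_smul (t n)⁻¹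
    rw [mem_ball_iff_norm, add_sub_cancel_left, norm_smul, Real.norm_of_nonneg (ht0 n).le]
    simp
    linarith [htr n]
  · filter_upwards [hd] with v hv
    rw [pderiv_eq_fderiv hv]
    have := (hv.hasFDerivAt.hasLineDerivAt (EuclideanSpace.single i 1)).tendsto_slope_zero
    exact this.comp htl

end PartialDerivatives

/-! ### Measurability of the composite density -/

section Density

variable {D g : ℕ}

lemma measurable_gammaDensity (φ : ℝ) :
    Measurable fun p : ℝ × ℝ => gammaDensity p.1 φ p.2 := by
  unfold gammaDensity
  refine Measurable.ite (measurableSet_lt measurable_const measurable_snd) ?_ measurable_const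
  fun_prop

lemma measurable_lomaxDensity (θ : ℝ) :
    Measurable fun p : ℝ × ℝ => lomaxDensity θ p.1 p.2 := by
  unfold lomaxDensity
  refine Measurable.ite (measurableSet_lt measurable_const measurable_snd) ?_ measurable_const
  fun_prop

lemma measurable_gammaCdf (φ τ : ℝ) : Measurable fun μ => gammaCdf μ φ τ :=
  ((measurable_gammaDensity φ).stronglyMeasurable.integral_prod_right
    (ν := volume.restrict (Iic τ))).measurable

lemma measurable_lomaxCdf (θ τ : ℝ) : Measurable fun η => lomaxCdf θ η τ :=
  ((measurable_lomaxDensity θ).stronglyMeasurable.integral_prod_right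
    (ν := volume.restrict (Iic τ))).measurable

lemma measurable_compositeDensity (τ : ℝ) (Φ : Par D g) :
    Measurable fun v : Obs D => compositeDensity τ v Φ := by
  have hlin : ∀ a : Fin D → ℝ, Measurable fun v : Obs D => Real.exp (∑ d, a d * v.2 d) :=
    fun a => by fun_prop
  have hden : Measurable fun v : Obs D => weightDenom Φ v.2 := by
    unfold weightDenom
    fun_prop
  unfold compositeDensity bodyWeight tailWeight
  refine (Finset.measurable_sum _ fun j _ => ?_).add ?_
  · refine (((hlin fun d => Φ.alpha d j).div hden).mul ((?_ : Measurable _).div ?_)).mul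
      (Measurable.ite (measurableSet_le measurable_fst measurable_const) measurable_const
        measurable_const)
    · exact (measurable_gammaDensity (Φ.phi j)).comp
        ((hlin fun d => Φ.beta d j).prodMk measurable_fst)
    · exact (measurable_gammaCdf (Φ.phi j) τ).comp (hlin fun d => Φ.beta d j)
  · refine ((measurable_const.div hden).mul ((?_ : Measurable _).div ?_)).mul
      (Measurable.ite (measurableSet_lt measurable_const measurable_fst) measurable_const
        measurable_const)
    · exact (measurable_lomaxDensity Φ.theta).comp ((hlin fun d => Φ.nu d).prodMk measurable_fst)
    · exact measurable_const.sub ((measurable_lomaxCdf Φ.theta τ).comp (hlin fun d => Φ.nu d))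

lemma measurable_logDensity (τ : ℝ) (Φ : Par D g) :
    Measurable fun v : Obs D => logDensity τ v Φ :=
  Real.measurable_log.comp (measurable_compositeDensity τ Φ)

end Density

/-! ### Local smoothness and moments of the score -/

section Regularity

variable {D g : ℕ} {τ : ℝ} {μX : Measure (Fin D → ℝ)} {Θ : Set (Par D g)} {Φ₀ : Par D g}

/-- The log-density of the observation `v` is three times continuously differentiable on the ball
of radius `r`, with second and third partial derivatives bounded by `B`. -/
structure SmoothOnBall (τ : ℝ) (Φ₀ : Par D g) (r : ℝ) (v : Obs D) (B : ℝ) : Prop where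
  nonneg : 0 ≤ B
  contDiffAt : ∀ Φ ∈ Metric.ball Φ₀ r, ContDiffAt ℝ 3 (logDensity τ v) Φ
  second_le : ∀ Φ ∈ Metric.ball Φ₀ r, ∀ i j, |pderiv i (pderiv j (logDensity τ v)) Φ| ≤ B
  third_le : ∀ Φ ∈ Metric.ball Φ₀ r, ∀ i j k,
    |pderiv i (pderiv j (pderiv k (logDensity τ v))) Φ| ≤ B

/-- Almost every observation has nonzero density at `Φ₀`, hence at every parameter in `Θ` by the
common support, so the logarithm inherits the smoothness of the density on a ball within `Θ`. -/
lemma RegularModel.exists_smoothOnBall (h : RegularModel τ μX Θ Φ₀) (hΦ₀ : Φ₀ ∈ interior Θ) :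
    ∃ r : ℝ, 0 < r ∧ Metric.ball Φ₀ r ⊆ Θ ∧ ∃ M : Obs D → ℝ, Integrable M (obsLaw τ μX Φ₀) ∧
      ∀ᵐ v ∂(obsLaw τ μX Φ₀), SmoothOnBall τ Φ₀ r v (M v) := by
  obtain ⟨M, hM, U, hU, hb⟩ := h.dominated
  obtain ⟨r, hr, hrU⟩ := Metric.mem_nhds_iff.1 (inter_mem hU (mem_interior_iff_mem_nhds.1 hΦ₀))
  have hΦΘ : Φ₀ ∈ Θ := interior_subset hΦ₀
  have hpos : ∀ᵐ v ∂(obsLaw τ μX Φ₀), compositeDensity τ v Φ₀ ≠ 0 := by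
    unfold obsLaw
    rw [ae_withDensity_iff (measurable_compositeDensity τ Φ₀).ennreal_ofReal]
    refine Eventually.of_forall fun v hv h0 => hv ?_
    simp [h0]
  refine ⟨r, hr, fun Φ hΦ => (hrU hΦ).2, M, hM, ?_⟩
  filter_upwards [hb, hpos, h.smooth] with v hv h0 hs
  -- The θ coordinate exists for all `D` and `g`, so the bound `M v` is nonnegative even if the
  -- other blocks are empty.
  let u : ParIdx D g := Sum.inr (Sum.inr (Sum.inr (Sum.inl ())))
  refine ⟨?_, fun Φ hΦ => ?_, fun Φ hΦ i j => (hv Φ (hrU hΦ).1 i j u).2.1, fun Φ hΦ i j k => (hv Φ (hrU hΦ).1 i j k).2.2⟩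
  · exact (abs_nonneg _).trans (hv Φ₀ (hrU (Metric.mem_ball_self hr)).1 u u u).1
  · refine (hs Φ (hrU hΦ).2).log ?_
    have := h.common_support Φ₀ hΦΘ Φ (hrU hΦ).2
    exact this.subset (show v ∈ Function.support fun v => compositeDensity τ v Φ₀ from h0)

namespace SmoothOnBall

variable {r B : ℝ} {v : Obs D}

lemma contDiffAt_pderiv (h : SmoothOnBall τ Φ₀ r v B) {Φ : Par D g} (hΦ : Φ ∈ Metric.ball Φ₀ r)
    (i : ParIdx D g) : ContDiffAt ℝ 2 (pderiv i (logDensity τ v)) Φ := by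
  exact_mod_cast ContDiffAt.pderiv (n := 2) (by exact_mod_cast h.contDiffAt Φ hΦ) i

lemma differentiableAt (h : SmoothOnBall τ Φ₀ r v B) {Φ : Par D g} (hΦ : Φ ∈ Metric.ball Φ₀ r) :
    DifferentiableAt ℝ (logDensity τ v) Φ :=
  (h.contDiffAt Φ hΦ).differentiableAt (by simp)

lemma differentiableAt_pderiv (h : SmoothOnBall τ Φ₀ r v B) {Φ : Par D g}
    (hΦ : Φ ∈ Metric.ball Φ₀ r) (i : ParIdx D g) :
    DifferentiableAt ℝ (pderiv i (logDensity τ v)) Φ :=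
  (h.contDiffAt_pderiv hΦ i).differentiableAt (by simp)

lemma abs_score_sub_le (h : SmoothOnBall τ Φ₀ r v B) {Φ : Par D g} (hΦ : Φ ∈ Metric.ball Φ₀ r)
    (i : ParIdx D g) :
    |pderiv i (logDensity τ v) Φ - pderiv i (logDensity τ v) Φ₀| ≤
      Fintype.card (ParIdx D g) * B * ‖Φ - Φ₀‖ :=
  abs_sub_le_of_pderiv_le (convex_ball Φ₀ r) (fun _ hz => h.differentiableAt_pderiv hz i) h.nonneg
    (fun z hz j => h.second_le z hz j i) (Metric.mem_ball_self (Metric.pos_of_mem_ball hΦ)) hΦ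

lemma abs_score_taylor_le (h : SmoothOnBall τ Φ₀ r v B) {Φ : Par D g}
    (hΦ : Φ ∈ Metric.ball Φ₀ r) (i : ParIdx D g) :
    |pderiv i (logDensity τ v) Φ - pderiv i (logDensity τ v) Φ₀ -
      ∑ j, (Φ - Φ₀) j * pderiv j (pderiv i (logDensity τ v)) Φ₀| ≤
      Fintype.card (ParIdx D g) * (Fintype.card (ParIdx D g) * B) * ‖Φ - Φ₀‖ ^ 2 :=
  abs_taylor_one_le (convex_ball Φ₀ r) (fun _ hz => h.contDiffAt_pderiv hz i) h.nonneg
    (fun z hz j k => h.third_le z hz j k i) (Metric.mem_ball_self (Metric.pos_of_mem_ball hΦ)) hΦ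

end SmoothOnBall

/-- Square integrability is the finiteness of the diagonal of the information matrix. -/
lemma RegularModel.memLp_score (h : RegularModel τ μX Θ Φ₀) (hΦ₀ : Φ₀ ∈ interior Θ)
    (i : ParIdx D g) :
    MemLp (fun v => pderiv i (logDensity τ v) Φ₀) 2 (obsLaw τ μX Φ₀) := by
  obtain ⟨r, hr, -, M, -, hs⟩ := h.exists_smoothOnBall hΦ₀
  have hm : AEMeasurable (fun v => pderiv i (logDensity τ v) Φ₀) (obsLaw τ μX Φ₀) := by
    refine aemeasurable_pderiv hr (fun Φ _ => (measurable_logDensity τ Φ).aemeasurable) ?_ i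
    filter_upwards [hs] with v hv using hv.differentiableAt (Metric.mem_ball_self hr)
  refine (memLp_two_iff_integrable_sq hm.aestronglyMeasurable).2 ?_
  simpa [sq] using h.information_finite i i

lemma RegularModel.integrable_pderiv_score (h : RegularModel τ μX Θ Φ₀) (hΦ₀ : Φ₀ ∈ interior Θ)
    (i j : ParIdx D g) :
    Integrable (fun v => pderiv i (pderiv j (logDensity τ v)) Φ₀) (obsLaw τ μX Φ₀) := by
  obtain ⟨r, hr, -, M, hM, hs⟩ := h.exists_smoothOnBall hΦ₀
  have hm : AEMeasurable (fun v => pderiv i (pderiv j (logDensity τ v)) Φ₀) (obsLaw τ μX Φ₀) := by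
    refine aemeasurable_pderiv (F := fun v => pderiv j (logDensity τ v)) hr (fun Φ hΦ => ?_) ?_ i
    -- The first derivative must be measurable at all nearby parameters before it can be
    -- differentiated again.
    · refine aemeasurable_pderiv (r := r - dist Φ Φ₀) (sub_pos.2 (Metric.mem_ball.1 hΦ))
        (fun Φ _ => (measurable_logDensity τ Φ).aemeasurable) ?_ j
      filter_upwards [hs] with v hv using hv.differentiableAt hΦ
    · filter_upwards [hs] with v hv using
        hv.differentiableAt_pderiv (Metric.mem_ball_self hr) j
  refine hM.mono' hm.aestronglyMeasurable ?_
  filter_upwards [hs] with v hv using hv.second_le Φ₀ (Metric.mem_ball_self hr) i j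

end Regularity

/-! ### The linear reparametrization and the penalty arguments -/

section LinearTransform

variable {D g : ℕ}

/-- `Φ ↦ (A₁ᵀ α, A₂ᵀ β, φ, θ, A₃ᵀ ν)` as a continuous linear map. -/
def linTransformL (A : Fin 3 → Matrix (Fin D) (Fin D) ℝ) : Par D g →L[ℝ] Par D g :=
  LinearMap.toContinuousLinearMap
    { toFun := linTransform A
      map_add' := fun Φ Ψ => by
        ext i
        rcases i with ⟨d, j⟩ | ⟨d, j⟩ | j | _ | d <;>
          simp [linTransform, Par.mk, Par.alpha, Par.beta, Par.phi, Par.theta, Par.nu, mul_add,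
            Finset.sum_add_distrib]
      map_smul' := fun a Φ => by
        ext i
        rcases i with ⟨d, j⟩ | ⟨d, j⟩ | j | _ | d <;>
          simp [linTransform, Par.mk, Par.alpha, Par.beta, Par.phi, Par.theta, Par.nu,
            Finset.mul_sum, mul_left_comm] }

/-- The factors appear in reverse order because the blocks are multiplied by transposes. -/
lemma linTransform_linTransform (A B : Fin 3 → Matrix (Fin D) (Fin D) ℝ) (Φ : Par D g) :
    linTransform A (linTransform B Φ) = linTransform (fun l => B l * A l) Φ := by
  have key : ∀ (l : Fin 3) (d : Fin D) (a : Fin D → ℝ),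
      ∑ e, A l e d * ∑ e', B l e' e * a e' = ∑ e, (∑ e', B l e e' * A l e' d) * a e := by
    intro l d a
    simp only [Finset.mul_sum, Finset.sum_mul]
    rw [Finset.sum_comm]
    exact Finset.sum_congr rfl fun _ _ => Finset.sum_congr rfl fun _ _ => by ring
  ext i
  rcases i with ⟨d, j⟩ | ⟨d, j⟩ | j | _ | d <;>
    simp [linTransform, Par.mk, Par.alpha, Par.beta, Par.phi, Par.theta, Par.nu, Matrix.mul_apply,
      key]

lemma linTransform_one (Φ : Par D g) : linTransform (fun _ => 1) Φ = Φ := by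
  ext i
  rcases i with ⟨d, j⟩ | ⟨d, j⟩ | j | _ | d <;>
    simp [linTransform, Par.mk, Par.alpha, Par.beta, Par.phi, Par.theta, Par.nu, Matrix.one_apply]

lemma toStar_fromStar {C : Fin 3 → Matrix (Fin D) (Fin D) ℝ} (hC : ∀ l, IsUnit (C l).det)
    (x : Par D g) : toStar C (fromStar C x) = x := by
  unfold toStar fromStar
  rw [linTransform_linTransform]
  simp_rw [Matrix.nonsing_inv_mul _ (hC _)]
  exact linTransform_one x

lemma fromStar_toStar {C : Fin 3 → Matrix (Fin D) (Fin D) ℝ} (hC : ∀ l, IsUnit (C l).det)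
    (Φ : Par D g) : fromStar C (toStar C Φ) = Φ := by
  unfold toStar fromStar
  rw [linTransform_linTransform]
  simp_rw [Matrix.mul_nonsing_inv _ (hC _)]
  exact linTransform_one Φ

/-- `cᵀα`, `cᵀβ` or `cᵀν`, as a vector indexed by the body components and the tail component. -/
def penVec (l : Fin 3) (c : Fin D → ℝ) (Φ : Par D g) : Fin g ⊕ Unit → ℝ :=
  match l with
  | 0 => Sum.elim (fun j => ∑ d, c d * Φ.alpha d j) 0
  | 1 => Sum.elim (fun j => ∑ d, c d * Φ.beta d j) 0
  | 2 => Sum.elim 0 fun _ => ∑ d, c d * Φ.nu d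

lemma penVec_add_right (l : Fin 3) (c : Fin D → ℝ) (Φ Ψ : Par D g) :
    penVec l c (Φ + Ψ) = penVec l c Φ + penVec l c Ψ := by
  funext i
  fin_cases l <;> rcases i with j | _ <;>
    simp [penVec, Par.alpha, Par.beta, Par.nu, mul_add, Finset.sum_add_distrib]

lemma penVec_smul_right (l : Fin 3) (c : Fin D → ℝ) (a : ℝ) (Φ : Par D g) :
    penVec l c (a • Φ) = a • penVec l c Φ := by
  funext i
  fin_cases l <;> rcases i with j | _ <;>
    simp [penVec, Par.alpha, Par.beta, Par.nu, Finset.mul_sum, mul_left_comm]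

lemma penVec_add_left (l : Fin 3) (c c' : Fin D → ℝ) (Φ : Par D g) :
    penVec l (c + c') Φ = penVec l c Φ + penVec l c' Φ := by
  funext i
  fin_cases l <;> rcases i with j | _ <;>
    simp [penVec, add_mul, Finset.sum_add_distrib]

lemma penVec_smul_left (l : Fin 3) (c : Fin D → ℝ) (a : ℝ) (Φ : Par D g) :
    penVec l (a • c) Φ = a • penVec l c Φ := by
  funext i
  fin_cases l <;> rcases i with j | _ <;>
    simp [penVec, Finset.mul_sum, mul_assoc]

/-- The linear map whose norm is the argument of a penalty term. -/
def penMap (l : Fin 3) (c : Fin D → ℝ) : Par D g →L[ℝ] EuclideanSpace ℝ (Fin g ⊕ Unit) :=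
  LinearMap.toContinuousLinearMap
    { toFun := fun Φ => WithLp.toLp 2 (penVec l c Φ)
      map_add' := fun Φ Ψ => by rw [penVec_add_right]; rfl
      map_smul' := fun a Φ => by rw [penVec_smul_right]; rfl }

lemma penMap_apply (l : Fin 3) (c : Fin D → ℝ) (Φ : Par D g) :
    penMap l c Φ = WithLp.toLp 2 (penVec l c Φ) := rfl

lemma norm_penMap (l : Fin 3) (c : Fin D → ℝ) (Φ : Par D g) : ‖penMap l c Φ‖ = penArg l c Φ := by
  rw [penMap_apply, EuclideanSpace.norm_eq]
  fin_cases l <;> simp [penVec, penArg, Real.sqrt_sq_eq_abs]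

/-- `penVec` is linear in the coefficient vector as well. -/
lemma penMap_eq_zero_of_mem_span {l : Fin 3} {s : Set (Fin D → ℝ)} {Φ : Par D g}
    (hs : ∀ c ∈ s, penMap l c Φ = 0) {c : Fin D → ℝ} (hc : c ∈ Submodule.span ℝ s) :
    penMap l c Φ = 0 := by
  have h0 : ∀ c, penMap l c Φ = 0 ↔ penVec l c Φ = 0 := fun c => by
    rw [penMap_apply]
    exact WithLp.toLp_eq_zero 2
  simp only [h0] at hs ⊢
  induction hc using Submodule.span_induction with
  | mem x hx => exact hs x hx
  | zero => simpa using penVec_smul_left l 0 0 Φ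
  | add x y _ _ hx hy => rw [penVec_add_left, hx, hy, add_zero]
  | smul a x _ hx => rw [penVec_smul_left, hx, smul_zero]

lemma penMap_col_eq_zero {C : Fin 3 → Matrix (Fin D) (Fin D) ℝ} {m : Fin 3 → ℕ} {Φ : Par D g}
    (h : ∀ i, IsRed m i → toStar C Φ i = 0) {l : Fin 3} {d : Fin D} (hd : d.val < m l) :
    penMap l ((C l).col d) Φ = 0 := by
  rw [penMap_apply]
  refine (WithLp.toLp_eq_zero 2).2 ?_
  funext i
  fin_cases l
  · rcases i with j | _
    · exact h (Sum.inl (d, j)) hd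
    · rfl
  · rcases i with j | _
    · exact h (Sum.inr (Sum.inl (d, j))) hd
    · rfl
  · rcases i with j | _
    · rfl
    · exact h (Sum.inr (Sum.inr (Sum.inr (Sum.inr d)))) hd

lemma abs_toStar_le_penArg (C : Fin 3 → Matrix (Fin D) (Fin D) ℝ) {m : Fin 3 → ℕ} (Φ : Par D g)
    {i : ParIdx D g} (hi : IsRed m i) :
    ∃ (l : Fin 3) (d : Fin D), d.val < m l ∧ |toStar C Φ i| ≤ penArg l ((C l).col d) Φ := by
  rcases i with ⟨d, j⟩ | ⟨d, j⟩ | j | _ | d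
  · refine ⟨0, d, hi, ?_⟩
    rw [← norm_penMap]
    exact PiLp.norm_apply_le (penMap 0 ((C 0).col d) Φ) (Sum.inl j)
  · refine ⟨1, d, hi, ?_⟩
    rw [← norm_penMap]
    exact PiLp.norm_apply_le (penMap 1 ((C 1).col d) Φ) (Sum.inl j)
  · exact hi.elim
  · exact hi.elim
  · refine ⟨2, d, hi, ?_⟩
    rw [← norm_penMap]
    exact PiLp.norm_apply_le (penMap 2 ((C 2).col d) Φ) (Sum.inr ())

variable {K : Fin 3 → ℕ} {c : ∀ l, Fin (K l) → Fin D → ℝ} {Φ₀ : Par D g} {m : Fin 3 → ℕ}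
  {C : Fin 3 → Matrix (Fin D) (Fin D) ℝ}

/-- This is where the spanning half of `IsReduction` enters: the reduced coordinates are the penalty
vectors of the first columns, and these columns span all the vanishing ones. -/
lemma penMap_eq_zero_of_red_eq_zero (hC : ∀ l, IsReduction (c l) (zeroSet c Φ₀ l) (m l) (C l))
    {Φ : Par D g} (h : ∀ i, IsRed m i → toStar C Φ i = 0) {l : Fin 3} {k : Fin (K l)}
    (hk : k ∈ zeroSet c Φ₀ l) : penMap l (c l k) Φ = 0 := by
  refine penMap_eq_zero_of_mem_span ?_ ((hC l).red_span k hk)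
  rintro _ ⟨j, hj, rfl⟩
  exact penMap_col_eq_zero h hj

/-- This is where the other half of `IsReduction` enters: each of the first columns is itself a
vanishing penalty vector, so a reduced coordinate is an entry of a vector whose norm is penalized.
-/
lemma exists_abs_red_le (hC : ∀ l, IsReduction (c l) (zeroSet c Φ₀ l) (m l) (C l))
    (Φ : Par D g) {i : ParIdx D g} (hi : IsRed m i) :
    ∃ (l : Fin 3) (k : Fin (K l)), k ∈ zeroSet c Φ₀ l ∧
      |toStar C Φ i| ≤ penArg l (c l k) Φ := by
  obtain ⟨l, d, hd, h⟩ := abs_toStar_le_penArg C Φ hi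
  obtain ⟨k, hk, hck⟩ := (hC l).red_mem d hd
  exact ⟨l, k, hk, hck ▸ h⟩

lemma toStar_true_red (hC : ∀ l, IsReduction (c l) (zeroSet c Φ₀ l) (m l) (C l))
    {i : ParIdx D g} (hi : IsRed m i) : toStar C Φ₀ i = 0 := by
  obtain ⟨l, k, hk, h⟩ := exists_abs_red_le hC Φ₀ hi
  rw [show penArg l (c l k) Φ₀ = 0 from hk] at h
  exact abs_eq_zero.1 (le_antisymm h (abs_nonneg _))

/-- `Φ* ↦ (Φ*_red, 0)`. -/
def redPart (m : Fin 3 → ℕ) (x : Par D g) : Par D g :=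
  WithLp.toLp 2 fun i => if IsRed m i then x i else 0

lemma norm_redPart_le {x : Par D g} {d : ℝ} (hd : 0 ≤ d) (h : ∀ i, IsRed m i → |x i| ≤ d) :
    ‖redPart m x‖ ≤ Fintype.card (ParIdx D g) * d := by
  have h1 : redPart m x = ∑ i, redPart m x i • EuclideanSpace.single i (1 : ℝ) := by
    conv_lhs => rw [← (EuclideanSpace.basisFun (ParIdx D g) ℝ).sum_repr (redPart m x)]
    simp
  rw [h1]
  refine (norm_sum_le _ _).trans ((Finset.sum_le_sum (g := fun _ => d) fun i _ => ?_).trans ?_)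
  · rw [norm_smul]
    simp only [redPart, PiLp.norm_single, norm_one, mul_one, Real.norm_eq_abs]
    split_ifs with hi
    · exact h i hi
    · simpa using hd
  · simp

/-- `Φ*_ind ↦ Φ`, with `Φ*_red = 0`. -/
def reducedMap (C : Fin 3 → Matrix (Fin D) (Fin D) ℝ) (m : Fin 3 → ℕ) :
    EuclideanSpace ℝ (IndIdx D g m) →L[ℝ] Par D g :=
  (linTransformL fun l => (C l)⁻¹).comp <| LinearMap.toContinuousLinearMap
    { toFun := withZeroRed m
      map_add' := fun x y => by
        ext i
        simp only [withZeroRed, PiLp.add_apply]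
        split_ifs <;> simp
      map_smul' := fun a x => by
        ext i
        simp only [withZeroRed, PiLp.smul_apply, RingHom.id_apply]
        split_ifs <;> simp }

lemma reducedMap_apply (ψ : EuclideanSpace ℝ (IndIdx D g m)) :
    reducedMap C m ψ = fromStar C (withZeroRed m ψ) := rfl

lemma withZeroRed_indPart {x : Par D g} (h : ∀ i, IsRed m i → x i = 0) :
    withZeroRed m (indPart m x) = x := by
  ext i
  simp only [withZeroRed, indPart]
  split_ifs with hi
  · exact (h i hi).symm
  · rfl

lemma reducedMap_indPart_toStar (hC : ∀ l, IsUnit (C l).det) {Φ : Par D g}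
    (h : ∀ i, IsRed m i → toStar C Φ i = 0) : reducedMap C m (indPart m (toStar C Φ)) = Φ := by
  rw [reducedMap_apply, withZeroRed_indPart h, fromStar_toStar hC]

lemma penMap_reducedMap (hC : ∀ l, IsReduction (c l) (zeroSet c Φ₀ l) (m l) (C l)) {l : Fin 3}
    {k : Fin (K l)} (hk : k ∈ zeroSet c Φ₀ l) (ψ : EuclideanSpace ℝ (IndIdx D g m)) :
    penMap l (c l k) (reducedMap C m ψ) = 0 := by
  refine penMap_eq_zero_of_red_eq_zero hC (fun i hi => ?_) hk
  rw [reducedMap_apply, toStar_fromStar fun l => (hC l).full_rank]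
  simp [withZeroRed, hi]

end LinearTransform

/-! ### One-dimensional estimates for a penalty function -/

section ConcavePenalty

/-- The point `x` may be a kink, so the slope is read off at a point `s` of differentiability in
`(x, δ)`, which exists because the exceptions are finite. By concavity the slope to the left of `x`
is at least that of `[x, s]`, which is at least `deriv q s`. -/
lemma ConcaveOn.le_sub_mul_of_le_deriv {q : ℝ → ℝ} (hq : ConcaveOn ℝ (Ici 0) q) {S : Set ℝ}
    (hS : S.Finite) (hd : ∀ ψ, 0 < ψ → ψ ∉ S → TwiceDifferentiableAt q ψ) {δ a : ℝ}
    (ha : ∀ s, 0 < s → s ≤ δ → DifferentiableAt ℝ q s → a ≤ deriv q s) {x t : ℝ} (hx : 0 ≤ x)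
    (hxδ : x < δ) (ht : 0 ≤ t) (ht1 : t ≤ 1) : q ((1 - t) * x) ≤ q x - t * x * a := by
  rcases ht.eq_or_lt with rfl | ht
  · simp
  rcases hx.eq_or_lt with rfl | hx
  · simp
  obtain ⟨s, ⟨hxs, hsδ⟩, hsS⟩ := ((Ioo_infinite hxδ).sdiff hS).nonempty
  have hs0 : 0 < s := hx.trans hxs
  have hds := (hd s hs0 hsS).1.self_of_nhds
  have hlt : (1 - t) * x < x := by nlinarith
  have h0 : 0 ≤ (1 - t) * x := mul_nonneg (by linarith) hx.le
  have h1 := hq.deriv_le_slope (mem_Ici.2 hx.le) (mem_Ici.2 hs0.le) hxs hds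
  have h2 := hq.slope_anti_adjacent (mem_Ici.2 h0) (mem_Ici.2 hs0.le) hlt hxs
  rw [slope_def_field] at h1
  have h3 := (ha s hs0 hsδ.le hds).trans (h1.trans h2)
  rw [le_div_iff₀ (by linarith)] at h3
  linarith

variable {q : ℝ → ℝ} {ψ₀ η b : ℝ}

lemma abs_deriv_sub_le (hη : 0 ≤ η)
    (h : ∀ ψ, |ψ - ψ₀| ≤ η → TwiceDifferentiableAt q ψ ∧ |deriv (deriv q) ψ| ≤ b) {ψ : ℝ}
    (hψ : |ψ - ψ₀| ≤ η) : |deriv q ψ - deriv q ψ₀| ≤ b * |ψ - ψ₀| :=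
  (convex_closedBall ψ₀ η).norm_image_sub_le_of_norm_deriv_le (fun x hx => (h x hx).1.2)
    (fun x hx => (h x hx).2) (Metric.mem_closedBall_self hη) hψ

lemma abs_sub_le_of_twiceDifferentiable (hη : 0 ≤ η) (hb : 0 ≤ b)
    (h : ∀ ψ, |ψ - ψ₀| ≤ η → TwiceDifferentiableAt q ψ ∧ |deriv (deriv q) ψ| ≤ b) {ψ ψ' : ℝ}
    (hψ : |ψ - ψ₀| ≤ η) (hψ' : |ψ' - ψ₀| ≤ η) :
    |q ψ' - q ψ| ≤ (|deriv q ψ₀| + b * η) * |ψ' - ψ| := by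
  refine (convex_closedBall ψ₀ η).norm_image_sub_le_of_norm_deriv_le
    (fun x hx => (h x hx).1.1.self_of_nhds) (fun x hx => ?_) hψ hψ'
  have h1 := abs_deriv_sub_le hη h hx
  have h2 : b * |x - ψ₀| ≤ b * η := mul_le_mul_of_nonneg_left hx hb
  rw [Real.norm_eq_abs]
  calc |deriv q x| = |deriv q ψ₀ + (deriv q x - deriv q ψ₀)| := by ring_nf
    _ ≤ |deriv q ψ₀| + |deriv q x - deriv q ψ₀| := abs_add_le _ _
    _ ≤ _ := by linarith

end ConcavePenalty

/-! ### Directional derivatives of the norm of a linear map -/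

section NormDerivative

variable {E F : Type*} [NormedAddCommGroup E] [NormedSpace ℝ E] [NormedAddCommGroup F]
  [InnerProductSpace ℝ F]

/-- The derivative of `x ↦ ‖A x‖` at `x` in the direction `w`, when `A x ≠ 0`. -/
def normDir (A : E →L[ℝ] F) (w x : E) : ℝ := inner ℝ (A x) (A w) / ‖A x‖

variable {A : E →L[ℝ] F} {x w : E}

lemma hasLineDerivAt_norm (hx : A x ≠ 0) (w : E) :
    HasLineDerivAt ℝ (fun y => ‖A y‖) (normDir A w x) x w := by
  have h1 : HasDerivAt (fun t : ℝ => A (x + t • w)) (A w) 0 := by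
    have h : HasDerivAt (fun t : ℝ => x + t • w) w 0 := by
      simpa using ((hasDerivAt_id (0 : ℝ)).smul_const w).const_add x
    exact A.hasFDerivAt.comp_hasDerivAt (0 : ℝ) h
  -- The squared norm is differentiable everywhere, and its square root away from zero.
  have h2 := h1.norm_sq.sqrt (by simpa using hx)
  have h3 : (fun t : ℝ => √(‖A (x + t • w)‖ ^ 2)) = fun t : ℝ => ‖A (x + t • w)‖ :=
    funext fun t => Real.sqrt_sq (norm_nonneg _)
  rw [h3] at h2
  refine h2.congr_deriv ?_
  rw [zero_smul, add_zero, Real.sqrt_sq (norm_nonneg _), normDir,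
    mul_div_mul_left _ _ two_ne_zero]

lemma abs_normDir_le (A : E →L[ℝ] F) (w x : E) : |normDir A w x| ≤ ‖A w‖ := by
  rw [normDir, abs_div, abs_norm]
  refine div_le_of_le_mul₀ (norm_nonneg _) (norm_nonneg _) ?_
  rw [mul_comm]
  exact abs_real_inner_le_norm _ _

lemma differentiableAt_normDir (hx : A x ≠ 0) (w : E) : DifferentiableAt ℝ (normDir A w) x := by
  have h1 : DifferentiableAt ℝ (fun y => A y) x := A.differentiableAt
  have h2 : DifferentiableAt ℝ (fun y => ‖A y‖) x := h1.norm ℝ hx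
  exact (h1.inner ℝ (differentiableAt_const (A w))).fun_mul (h2.fun_inv (norm_ne_zero_iff.2 hx))

lemma hasLineDerivAt_comp_norm {q : ℝ → ℝ} (hx : A x ≠ 0) (hq : DifferentiableAt ℝ q ‖A x‖)
    (w : E) :
    HasLineDerivAt ℝ (fun y => q ‖A y‖) (deriv q ‖A x‖ * normDir A w x) x w := by
  have h1 := hasLineDerivAt_norm hx w
  unfold HasLineDerivAt at h1 ⊢
  have h2 : HasDerivAt q (deriv q ‖A x‖) ((fun t : ℝ => ‖A (x + t • w)‖) 0) := by
    simpa using hq.hasDerivAt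
  exact h2.comp (0 : ℝ) h1

lemma hasLineDerivAt_deriv_comp_norm {q : ℝ → ℝ} (hx : A x ≠ 0)
    (hq : DifferentiableAt ℝ (deriv q) ‖A x‖) (w w' : E) :
    HasLineDerivAt ℝ (fun y => deriv q ‖A y‖ * normDir A w y)
      (deriv (deriv q) ‖A x‖ * normDir A w' x * normDir A w x +
        deriv q ‖A x‖ * lineDeriv ℝ (normDir A w) x w') x w' := by
  have h1 := hasLineDerivAt_comp_norm hx hq w'
  have h2 := (differentiableAt_normDir hx w).lineDifferentiableAt (v := w') |>.hasLineDerivAt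
  unfold HasLineDerivAt at h1 h2 ⊢
  refine (h1.fun_mul h2).congr_deriv ?_
  simp only [zero_smul, add_zero]

end NormDerivative

/-! ### Calculus of O_P(1) -/

section BoundedInProb

variable {Ω : Type*} [MeasurableSpace Ω] {P : Measure Ω} {X Y : ℕ → Ω → ℝ}

lemma BoundedInProb.of_abs_le_mul {a : ℝ} (hX : BoundedInProb P X)
    (h : ∀ n ω, |Y n ω| ≤ a * |X n ω|) : BoundedInProb P Y := by
  intro ε hε
  obtain ⟨A, hA⟩ := hX ε hε
  refine ⟨|a| * |A|, ?_⟩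
  filter_upwards [hA] with n hn
  refine (measure_mono fun ω hω => ?_).trans hn
  simp only [mem_ofPred_eq] at hω ⊢
  by_contra hc
  have h1 : |X n ω| ≤ |A| := (not_lt.1 hc).trans (le_abs_self A)
  have h2 : a * |X n ω| ≤ |a| * |A| :=
    mul_le_mul (le_abs_self a) h1 (abs_nonneg _) (abs_nonneg _)
  linarith [h n ω]

lemma BoundedInProb.add (hX : BoundedInProb P X) (hY : BoundedInProb P Y) :
    BoundedInProb P fun n ω => X n ω + Y n ω := by
  intro ε hε
  obtain ⟨A, hA⟩ := hX (ε / 2) (ENNReal.half_pos hε.ne')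
  obtain ⟨B, hB⟩ := hY (ε / 2) (ENNReal.half_pos hε.ne')
  refine ⟨A + B, ?_⟩
  filter_upwards [hA, hB] with n h1 h2
  calc P {ω | A + B < |X n ω + Y n ω|} ≤ P ({ω | A < |X n ω|} ∪ {ω | B < |Y n ω|}) := by
        refine measure_mono fun ω hω => ?_
        by_contra hc
        simp only [mem_union, mem_ofPred_eq, not_or, not_lt] at hω hc
        linarith [abs_add_le (X n ω) (Y n ω)]
    _ ≤ ε / 2 + ε / 2 := (measure_union_le _ _).trans (add_le_add h1 h2)
    _ = ε := ENNReal.add_halves ε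

lemma boundedInProb_sum_abs {κ : Type*} (s : Finset κ) {X : κ → ℕ → Ω → ℝ}
    (h : ∀ k ∈ s, BoundedInProb P (X k)) : BoundedInProb P fun n ω => ∑ k ∈ s, |X k n ω| := by
  classical
  induction s using Finset.induction_on with
  | empty => exact fun ε _ => ⟨0, by simp⟩
  | insert k s hk ih =>
    simp_rw [Finset.sum_insert hk]
    refine BoundedInProb.add ?_ (ih fun j hj => h j (Finset.mem_insert_of_mem hj))
    exact (h k (Finset.mem_insert_self k s)).of_abs_le_mul (a := 1) fun n ω => by simp

/-- O_P(1) times o_P(1) is o_P(1). -/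
lemma BoundedInProb.tendsto_mul_zero (hX : BoundedInProb P X)
    (hY : Tendsto (fun p : ℕ × Ω => Y p.1 p.2) (whp P) (𝓝 0)) :
    Tendsto (fun p : ℕ × Ω => X p.1 p.2 * Y p.1 p.2) (whp P) (𝓝 0) := by
  rw [Metric.tendsto_nhds] at hY ⊢
  intro ε hε
  refine eventually_whp_of_bounded hX (Q := fun n ω => dist (X n ω * Y n ω) 0 < ε) fun A => ?_
  filter_upwards [hY (ε / (|A| + 1)) (by positivity)] with p hp hA
  rw [Real.dist_eq, sub_zero] at hp ⊢
  rw [abs_mul]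
  calc |X p.1 p.2| * |Y p.1 p.2| ≤ (|A| + 1) * |Y p.1 p.2| := by
        gcongr
        linarith [le_abs_self A]
    _ < (|A| + 1) * (ε / (|A| + 1)) := by gcongr
    _ = ε := by field_simp

lemma tendsto_div_sqrt_nat (a : ℝ) : Tendsto (fun n : ℕ => a / √n) atTop (𝓝 0) :=
  tendsto_const_nhds.div_atTop (Real.tendsto_sqrt_atTop.comp tendsto_natCast_atTop_atTop)

end BoundedInProb

/-! ### Sums of penalties composed with norms -/

section PenaltySum

variable {κ : Type*} [Fintype κ] {Ω : Type*} [MeasurableSpace Ω] {P : Measure Ω}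

/-- Regularity of the random penalty functions `q k n ω`, whose true arguments are `N₀ k`. -/
structure RegularPenaltyAt (P : Measure Ω) (N₀ : κ → ℝ) (q : κ → ℕ → Ω → ℝ → ℝ) : Prop where
  concave : ∀ k n ω, ConcaveOn ℝ (Ici 0) (q k n ω)
  at_zero : ∀ k n ω, q k n ω 0 = 0
  twice_diff : ∀ k n ω, ∃ S : Set ℝ, S.Finite ∧ ∀ ψ, 0 < ψ → ψ ∉ S →
    TwiceDifferentiableAt (q k n ω) ψ
  second_deriv : ∀ k, N₀ k ≠ 0 → ∀ C : ℝ, 0 < C → ∀ ε : ℝ, 0 < ε →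
    ∀ᶠ p in whp P, ∀ ψ, |ψ - N₀ k| ≤ C / √p.1 → TwiceDifferentiableAt (q k p.1 p.2) ψ ∧
      |deriv (deriv (q k p.1 p.2)) ψ| / p.1 ≤ ε
  steep_at_zero : ∀ k, N₀ k = 0 → ∀ a : ℝ, ∀ᶠ p in whp P, ∀ ψ, 0 < ψ → ψ ≤ Real.log p.1 / √p.1 →
    DifferentiableAt ℝ (q k p.1 p.2) ψ → a ≤ deriv (q k p.1 p.2) ψ / √p.1
  first_deriv : ∀ k, N₀ k ≠ 0 → BoundedInProb P fun n ω => deriv (q k n ω) (N₀ k) / √n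

lemma RegularPenalty.regularPenaltyAt {D g : ℕ} {K : Fin 3 → ℕ}
    {c : ∀ l, Fin (K l) → Fin D → ℝ} {pen : Fin 3 → ℕ → Ω → ℝ → ℝ → ℝ}
    {lam : ∀ l, Fin (K l) → ℕ → Ω → ℝ} {Φ₀ : Par D g} (h : RegularPenalty P c pen lam Φ₀) :
    RegularPenaltyAt P (fun k : Σ l, Fin (K l) => penArg k.1 (c k.1 k.2) Φ₀)
      (fun k n ω s => pen k.1 n ω s (lam k.1 k.2 n ω)) where
  concave k := h.concave k.1 k.2
  at_zero k := h.at_zero k.1 k.2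
  twice_diff k := h.twice_diff k.1 k.2
  second_deriv k hk C hC ε hε := by
    refine (eventually_whp_iff fun n ω => ∀ ψ, |ψ - penArg k.1 (c k.1 k.2) Φ₀| ≤ C / √n →
      TwiceDifferentiableAt (fun s => pen k.1 n ω s (lam k.1 k.2 n ω)) ψ ∧
        |deriv (deriv fun s => pen k.1 n ω s (lam k.1 k.2 n ω)) ψ| / n ≤ ε).2 ?_
    refine (h.second_deriv k.1 k.2 hk C hC ε hε).congr fun n => ?_
    congr 1
    ext ω
    simp only [mem_ofPred_eq, not_forall, exists_prop]
  steep_at_zero k hk a := by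
    refine (eventually_whp_iff fun n ω => ∀ ψ, 0 < ψ → ψ ≤ Real.log n / √n →
      DifferentiableAt ℝ (fun s => pen k.1 n ω s (lam k.1 k.2 n ω)) ψ →
        a ≤ deriv (fun s => pen k.1 n ω s (lam k.1 k.2 n ω)) ψ / √n).2 ?_
    refine (h.steep_at_zero k.1 k.2 hk a).congr fun n => ?_
    congr 1
    ext ω
    simp only [mem_ofPred_eq, not_forall, exists_prop, not_le]
  first_deriv k hk := h.first_deriv k.1 k.2 hk

namespace RegularPenaltyAt

variable {N₀ : κ → ℝ} {q : κ → ℕ → Ω → ℝ → ℝ}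

lemma eventually_local (h : RegularPenaltyAt P N₀ q) {C ε : ℝ} (hC : 0 < C) (hε : 0 < ε) :
    ∀ᶠ p in whp P, ∀ k, N₀ k ≠ 0 → ∀ ψ, |ψ - N₀ k| ≤ C / √p.1 →
      TwiceDifferentiableAt (q k p.1 p.2) ψ ∧ |deriv (deriv (q k p.1 p.2)) ψ| ≤ ε * p.1 := by
  refine eventually_all.2 fun k => ?_
  by_cases hk : N₀ k = 0
  · exact Eventually.of_forall fun p h => absurd hk h
  filter_upwards [h.second_deriv k hk C hC ε hε,
    (tendsto_fst_whp P).eventually (eventually_gt_atTop 0)] with p hp hn _ ψ hψ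
  have hn' : (0 : ℝ) < p.1 := by exact_mod_cast hn
  exact ⟨(hp ψ hψ).1, (div_le_iff₀ hn').1 (hp ψ hψ).2⟩

lemma eventually_steep (h : RegularPenaltyAt P N₀ q) (a : ℝ) :
    ∀ᶠ p in whp P, ∀ k, N₀ k = 0 → ∀ ψ, 0 < ψ → ψ ≤ Real.log p.1 / √p.1 →
      DifferentiableAt ℝ (q k p.1 p.2) ψ → a * √p.1 ≤ deriv (q k p.1 p.2) ψ := by
  refine eventually_all.2 fun k => ?_
  by_cases hk : N₀ k = 0
  · filter_upwards [h.steep_at_zero k hk a,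
      (tendsto_fst_whp P).eventually (eventually_gt_atTop 0)] with p hp hn _ ψ h0 hψ hd
    have hn' : (0 : ℝ) < p.1 := by exact_mod_cast hn
    exact (le_div_iff₀ (Real.sqrt_pos.2 hn')).1 (hp ψ h0 hψ hd)
  · exact Eventually.of_forall fun p h => absurd h hk

open Classical in
lemma eventually_of_first_deriv (h : RegularPenaltyAt P N₀ q) {Q : ℕ → Ω → Prop}
    (hQ : ∀ B, 0 ≤ B → ∀ᶠ p in whp P,
      (∀ k, N₀ k ≠ 0 → |deriv (q k p.1 p.2) (N₀ k)| ≤ B * √p.1) → Q p.1 p.2) :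
    ∀ᶠ p in whp P, Q p.1 p.2 := by
  refine eventually_whp_of_bounded (boundedInProb_sum_abs (Finset.univ.filter fun k => N₀ k ≠ 0)
    (X := fun k n ω => deriv (q k n ω) (N₀ k) / √n) fun k hk =>
    h.first_deriv k (Finset.mem_filter.1 hk).2) fun B => ?_
  filter_upwards [hQ (max B 0) (le_max_right _ _),
    (tendsto_fst_whp P).eventually (eventually_gt_atTop 0)] with p hp hn hB
  refine hp fun k hk => ?_
  have hn' : (0 : ℝ) < p.1 := by exact_mod_cast hn
  rw [abs_of_nonneg (Finset.sum_nonneg fun _ _ => abs_nonneg _)] at hB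
  have h1 := (Finset.single_le_sum (f := fun k => |deriv (q k p.1 p.2) (N₀ k) / √p.1|)
    (fun _ _ => abs_nonneg _) (Finset.mem_filter.2 ⟨Finset.mem_univ k, hk⟩)).trans hB
  rw [abs_div, abs_of_pos (Real.sqrt_pos.2 hn'), div_le_iff₀ (Real.sqrt_pos.2 hn')] at h1
  exact h1.trans (by gcongr; exact le_max_left _ _)

end RegularPenaltyAt

variable {E F : Type*} [NormedAddCommGroup E] [NormedSpace ℝ E] [NormedAddCommGroup F]
  [InnerProductSpace ℝ F]

open Classical in
/-- The derivative of `y ↦ ∑ k, q k ‖A k y‖` at `x` in the direction `w`, where only the terms with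
`A k ≠ 0` contribute. -/
def penGrad (A : κ → E →L[ℝ] F) (q : κ → ℝ → ℝ) (w x : E) : ℝ :=
  ∑ k, if A k = 0 then 0 else deriv (q k) ‖A k x‖ * normDir (A k) w x

lemma hasLineDerivAt_penSum {A : κ → E →L[ℝ] F} {q : κ → ℝ → ℝ} {x : E}
    (h : ∀ k, A k ≠ 0 → A k x ≠ 0 ∧ DifferentiableAt ℝ (q k) ‖A k x‖) (w : E) :
    HasLineDerivAt ℝ (fun y => ∑ k, q k ‖A k y‖) (penGrad A q w x) x w := by
  refine HasDerivAt.fun_sum (A := fun k t => q k ‖A k (x + t • w)‖) fun k _ => ?_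
  split_ifs with hk
  · simpa [hk] using hasDerivAt_const (0 : ℝ) (q k 0)
  · exact hasLineDerivAt_comp_norm (h k hk).1 (h k hk).2 w

open Classical in
lemma abs_lineDeriv_penGrad_le {A : κ → E →L[ℝ] F} {q : κ → ℝ → ℝ} {x : E}
    (h : ∀ k, A k ≠ 0 → A k x ≠ 0 ∧ DifferentiableAt ℝ (deriv (q k)) ‖A k x‖) (w w' : E) :
    |lineDeriv ℝ (penGrad A q w) x w'| ≤
      ∑ k, if A k = 0 then 0 else |deriv (deriv (q k)) ‖A k x‖| * (‖A k w'‖ * ‖A k w‖) +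
        |deriv (q k) ‖A k x‖| * |lineDeriv ℝ (normDir (A k) w) x w'| := by
  have h1 : HasLineDerivAt ℝ (penGrad A q w) (∑ k, if A k = 0 then 0 else
      deriv (deriv (q k)) ‖A k x‖ * normDir (A k) w' x * normDir (A k) w x +
        deriv (q k) ‖A k x‖ * lineDeriv ℝ (normDir (A k) w) x w') x w' := by
    refine HasDerivAt.fun_sum (A := fun k t => if A k = 0 then 0 else
      deriv (q k) ‖A k (x + t • w')‖ * normDir (A k) w (x + t • w')) fun k _ => ?_
    split_ifs with hk
    · exact hasDerivAt_const _ _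
    · exact hasLineDerivAt_deriv_comp_norm (h k hk).1 (h k hk).2 w w'
  rw [h1.lineDeriv]
  refine (Finset.abs_sum_le_sum_abs _ _).trans (Finset.sum_le_sum fun k _ => ?_)
  split_ifs with hk
  · simp
  · refine (abs_add_le _ _).trans (add_le_add ?_ (abs_mul _ _).le)
    rw [mul_assoc, abs_mul, abs_mul]
    gcongr <;> exact abs_normDir_le _ _ _

end PenaltySum

/-! ### Penalty gradient and Hessian near the truth -/

section PenaltyAsymptotics

variable {κ : Type*} [Fintype κ] {Ω : Type*} [MeasurableSpace Ω] {P : Measure Ω}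
  {N₀ : κ → ℝ} {q : κ → ℕ → Ω → ℝ → ℝ}
  {F : Type*} [NormedAddCommGroup F] [InnerProductSpace ℝ F]

lemma eventually_whp_of_sqrt_mul_norm {E : Type*} [SeminormedAddCommGroup E]
    {X : ℕ → Ω → E} {x₀ : E}
    (hX : BoundedInProb P fun n ω => √n * ‖X n ω - x₀‖) {Q : ℕ → Ω → Prop}
    (h : ∀ a, 0 ≤ a → ∀ᶠ p in whp P, ‖X p.1 p.2 - x₀‖ ≤ a / √p.1 → Q p.1 p.2) :
    ∀ᶠ p in whp P, Q p.1 p.2 := by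
  refine eventually_whp_of_bounded hX fun a => ?_
  filter_upwards [h (max a 0) (le_max_right _ _),
    (tendsto_fst_whp P).eventually (eventually_gt_atTop 0)] with p hp hn ha
  have hn' : (0 : ℝ) < √p.1 := Real.sqrt_pos.2 (by exact_mod_cast hn)
  rw [abs_of_nonneg (by positivity)] at ha
  refine hp ((le_div_iff₀ hn').2 ?_)
  rw [mul_comm]
  exact ha.trans (le_max_left _ _)

lemma tendsto_whp_zero_of_abs_le {X : ℕ → Ω → ℝ}
    (h : ∀ ε, 0 < ε → ∀ᶠ p in whp P, |X p.1 p.2| ≤ ε) :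
    Tendsto (fun p : ℕ × Ω => X p.1 p.2) (whp P) (𝓝 0) := by
  rw [Metric.tendsto_nhds]
  intro ε hε
  filter_upwards [h (ε / 2) (half_pos hε)] with p hp
  rw [Real.dist_eq, sub_zero]
  linarith

lemma natCast_eq_sqrt_mul_sqrt (n : ℕ) : (n : ℝ) = √n * √n :=
  (Real.mul_self_sqrt (Nat.cast_nonneg n)).symm

section Gradient

variable {E : Type*} [NormedAddCommGroup E] [NormedSpace ℝ E] {A : κ → E →L[ℝ] F} {x₀ : E}
  {X : ℕ → Ω → E}

/-- Arguments move by O(n^{-1/2}), so those with nonzero true value stay away from zero and within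
the range where `q k n ω` is smooth. -/
lemma RegularPenaltyAt.eventually_differentiableAt (h : RegularPenaltyAt P N₀ q)
    (hN : ∀ k, ‖A k x₀‖ = N₀ k) (hA : ∀ k, N₀ k = 0 → A k = 0)
    (hX : BoundedInProb P fun n ω => √n * ‖X n ω - x₀‖) :
    ∀ᶠ p in whp P, ∀ k, A k ≠ 0 → A k (X p.1 p.2) ≠ 0 ∧
      DifferentiableAt ℝ (q k p.1 p.2) ‖A k (X p.1 p.2)‖ := by
  refine eventually_whp_of_sqrt_mul_norm hX (Q := fun n ω => ∀ k, A k ≠ 0 → A k (X n ω) ≠ 0 ∧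
      DifferentiableAt ℝ (q k n ω) ‖A k (X n ω)‖) fun a ha => ?_
  have hC : 0 < ∑ k, ‖A k‖ * a + 1 := by positivity
  have hsm : ∀ᶠ n : ℕ in atTop, ∀ k, A k ≠ 0 → (∑ k, ‖A k‖ * a + 1) / √n < N₀ k := by
    refine eventually_all.2 fun k => ?_
    by_cases hk : A k = 0
    · exact Eventually.of_forall fun n h => absurd hk h
    have : 0 < N₀ k := lt_of_le_of_ne (hN k ▸ norm_nonneg _) fun h => hk (hA k h.symm)
    filter_upwards [(tendsto_div_sqrt_nat _).eventually_lt_const this] with n hn _ using hn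
  filter_upwards [h.eventually_local hC one_pos, (tendsto_fst_whp P).eventually hsm] with
    p hp hs hXp k hk
  have hk0 : N₀ k ≠ 0 := fun h => hk (hA k h)
  have h1 : |‖A k (X p.1 p.2)‖ - N₀ k| ≤ (∑ k, ‖A k‖ * a + 1) / √p.1 := by
    rw [← hN k]
    calc |‖A k (X p.1 p.2)‖ - ‖A k x₀‖| ≤ ‖A k (X p.1 p.2) - A k x₀‖ := abs_norm_sub_norm_le _ _
      _ ≤ ‖A k‖ * ‖X p.1 p.2 - x₀‖ := by rw [← map_sub]; exact (A k).le_opNorm _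
      _ ≤ ‖A k‖ * (a / √p.1) := by gcongr
      _ = ‖A k‖ * a / √p.1 := by ring
      _ ≤ _ := by
        gcongr
        have := Finset.single_le_sum (f := fun k => ‖A k‖ * a) (fun _ _ => by positivity)
          (Finset.mem_univ k)
        linarith
  refine ⟨fun h0 => ?_, (hp k hk0 _ h1).1.1.self_of_nhds⟩
  rw [h0, norm_zero, zero_sub, abs_neg] at h1
  linarith [hs k hk, le_abs_self (N₀ k)]

/-- Each summand is q' times the derivative of a norm. Over a distance O(n^{-1/2}) the factor q'
changes by o(n)·O(n^{-1/2}) = o(√n), while the norm derivative changes by o(1) and is multiplied by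
q' = O(√n). -/
lemma RegularPenaltyAt.tendsto_penGrad_sub (h : RegularPenaltyAt P N₀ q)
    (hN : ∀ k, ‖A k x₀‖ = N₀ k) (hA : ∀ k, N₀ k = 0 → A k = 0)
    (hX : BoundedInProb P fun n ω => √n * ‖X n ω - x₀‖) (w : E) :
    Tendsto (fun p : ℕ × Ω => (penGrad A (fun k => q k p.1 p.2) w (X p.1 p.2) -
      penGrad A (fun k => q k p.1 p.2) w x₀) / √p.1) (whp P) (𝓝 0) := by
  classical
  refine tendsto_whp_zero_of_abs_le (X := fun n ω => (penGrad A (fun k => q k n ω) w (X n ω) -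
      penGrad A (fun k => q k n ω) w x₀) / √n) fun ε hε => ?_
  refine eventually_whp_of_sqrt_mul_norm hX (Q := fun n ω => |(penGrad A (fun k => q k n ω) w
    (X n ω) - penGrad A (fun k => q k n ω) w x₀) / √n| ≤ ε) fun a ha => ?_
  refine h.eventually_of_first_deriv (Q := fun n ω => ‖X n ω - x₀‖ ≤ a / √n → |(penGrad A (fun k => q k n ω) w
    (X n ω) - penGrad A (fun k => q k n ω) w x₀) / √n| ≤ ε) fun B hB => ?_
  have hC : 0 < ∑ k, ‖A k‖ * a + 1 := by positivity
  set W : ℝ := ∑ k, ‖A k‖ * a * ‖A k w‖ with hW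
  have hW0 : 0 ≤ W := by positivity
  -- `e` bounds the second derivatives relative to n and `δ` the change of the norm derivatives;
  -- each makes one of the two contributions at most ε/2, and the added ones avoid division by zero.
  set e : ℝ := ε / (2 * (W + 1)) with he
  set δ : ℝ := ε / (2 * (Fintype.card κ * B + 1)) with hδ
  have he0 : 0 < e := by positivity
  have hδ0 : 0 < δ := by positivity
  have hcont : ∀ᶠ y in 𝓝 x₀, ∀ k, A k ≠ 0 → |normDir (A k) w y - normDir (A k) w x₀| ≤ δ := by
    refine eventually_all.2 fun k => ?_
    by_cases hk : A k = 0
    · exact Eventually.of_forall fun n h => absurd hk h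
    have hk0 : A k x₀ ≠ 0 := fun h0 => hk (hA k (by rw [← hN k, h0, norm_zero]))
    filter_upwards [Metric.tendsto_nhds.1 (differentiableAt_normDir hk0 w).continuousAt δ hδ0]
      with y hy _ using hy.le
  obtain ⟨ρ, hρ, hball⟩ := Metric.eventually_nhds_iff.1 hcont
  filter_upwards [h.eventually_local hC he0, (tendsto_fst_whp P).eventually
    ((tendsto_div_sqrt_nat a).eventually_lt_const hρ),
    (tendsto_fst_whp P).eventually (eventually_gt_atTop 0)] with p hp hρp hn hB' hXp
  have hs : (0 : ℝ) < √p.1 := Real.sqrt_pos.2 (by exact_mod_cast hn)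
  have hy := hball (y := X p.1 p.2) (by rw [dist_eq_norm]; exact hXp.trans_lt hρp)
  rw [abs_div, abs_of_pos hs, div_le_iff₀ hs]
  unfold penGrad
  rw [← Finset.sum_sub_distrib]
  calc |∑ k, ((if A k = 0 then 0 else deriv (q k p.1 p.2) ‖A k (X p.1 p.2)‖ *
          normDir (A k) w (X p.1 p.2)) -
        (if A k = 0 then 0 else deriv (q k p.1 p.2) ‖A k x₀‖ * normDir (A k) w x₀))|
      ≤ ∑ k, (e * (‖A k‖ * a * ‖A k w‖) * √p.1 + B * δ * √p.1) := by
        refine (Finset.abs_sum_le_sum_abs _ _).trans (Finset.sum_le_sum fun k _ => ?_)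
        split_ifs with hk
        · simp only [sub_zero, abs_zero]; positivity
        have hk0 : N₀ k ≠ 0 := fun h => hk (hA k h)
        have h0 : |‖A k (X p.1 p.2)‖ - N₀ k| ≤ ‖A k‖ * a / √p.1 := by
          rw [← hN k]
          calc |‖A k (X p.1 p.2)‖ - ‖A k x₀‖| ≤ ‖A k (X p.1 p.2) - A k x₀‖ :=
                abs_norm_sub_norm_le _ _
            _ ≤ ‖A k‖ * ‖X p.1 p.2 - x₀‖ := by rw [← map_sub]; exact (A k).le_opNorm _
            _ ≤ ‖A k‖ * (a / √p.1) := by gcongr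
            _ = ‖A k‖ * a / √p.1 := by ring
        have h1 : |‖A k (X p.1 p.2)‖ - N₀ k| ≤ (∑ k, ‖A k‖ * a + 1) / √p.1 := by
          refine h0.trans ?_
          gcongr
          have := Finset.single_le_sum (f := fun k => ‖A k‖ * a) (fun _ _ => by positivity)
            (Finset.mem_univ k)
          linarith
        have h2 := abs_deriv_sub_le (by positivity) (hp k hk0) h1
        have h3 : |deriv (q k p.1 p.2) ‖A k (X p.1 p.2)‖ - deriv (q k p.1 p.2) ‖A k x₀‖| ≤
            e * (‖A k‖ * a) * √p.1 := by
          rw [hN k]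
          refine h2.trans ?_
          calc e * p.1 * |‖A k (X p.1 p.2)‖ - N₀ k| ≤ e * p.1 * (‖A k‖ * a / √p.1) := by gcongr
            _ = e * (‖A k‖ * a) * √p.1 := by
              rw [mul_div_assoc', div_eq_iff hs.ne']
              linear_combination (e * (‖A k‖ * a)) * natCast_eq_sqrt_mul_sqrt p.1
        have h4 := hy k hk
        have h5 := hB' k hk0
        rw [← hN k] at h5
        calc |deriv (q k p.1 p.2) ‖A k (X p.1 p.2)‖ * normDir (A k) w (X p.1 p.2) -
              deriv (q k p.1 p.2) ‖A k x₀‖ * normDir (A k) w x₀|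
            = |(deriv (q k p.1 p.2) ‖A k (X p.1 p.2)‖ - deriv (q k p.1 p.2) ‖A k x₀‖) *
                normDir (A k) w (X p.1 p.2) + deriv (q k p.1 p.2) ‖A k x₀‖ *
                (normDir (A k) w (X p.1 p.2) - normDir (A k) w x₀)| := by ring_nf
          _ ≤ e * (‖A k‖ * a) * √p.1 * ‖A k w‖ + B * √p.1 * δ := by
              refine (abs_add_le _ _).trans ?_
              rw [abs_mul, abs_mul]
              gcongr
              exact abs_normDir_le _ _ _
          _ = _ := by ring
    _ = (e * W + Fintype.card κ * B * δ) * √p.1 := by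
        rw [Finset.sum_add_distrib, ← Finset.sum_mul, ← Finset.mul_sum]
        simp
        ring
    _ ≤ ε * √p.1 := by
        gcongr
        have h1 : e * W ≤ ε / 2 := by
          rw [he, div_mul_eq_mul_div, div_le_div_iff₀ (by positivity) (by positivity)]
          nlinarith
        have h2 : Fintype.card κ * B * δ ≤ ε / 2 := by
          rw [hδ, mul_div_assoc', div_le_div_iff₀ (by positivity) (by positivity)]
          nlinarith
        linarith

end Gradient

section Hessian

variable {ι : Type*} [Fintype ι] [DecidableEq ι] {A : κ → EuclideanSpace ℝ ι →L[ℝ] F}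
  {x₀ : EuclideanSpace ℝ ι}

lemma pderiv_penSum {q : κ → ℝ → ℝ} {x : EuclideanSpace ℝ ι}
    (h : ∀ k, A k ≠ 0 → A k x ≠ 0 ∧ DifferentiableAt ℝ (q k) ‖A k x‖) (j : ι) :
    pderiv j (fun y => ∑ k, q k ‖A k y‖) x = penGrad A q (EuclideanSpace.single j 1) x :=
  (hasLineDerivAt_penSum h _).lineDeriv

/-- To differentiate again, the gradient formula must hold on a neighbourhood of `x₀`, not merely at
it. -/
lemma hessMatrix_penSum {q : κ → ℝ → ℝ}
    (h : ∀ k, A k ≠ 0 → A k x₀ ≠ 0 ∧ TwiceDifferentiableAt (q k) ‖A k x₀‖) (i j : ι) :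
    hessMatrix (fun y => ∑ k, q k ‖A k y‖) x₀ i j =
      lineDeriv ℝ (penGrad A q (EuclideanSpace.single j 1)) x₀ (EuclideanSpace.single i 1) := by
  refine Filter.EventuallyEq.lineDeriv_eq ?_
  have : ∀ᶠ x in 𝓝 x₀, ∀ k, A k ≠ 0 → A k x ≠ 0 ∧ DifferentiableAt ℝ (q k) ‖A k x‖ := by
    refine eventually_all.2 fun k => ?_
    by_cases hk : A k = 0
    · exact Eventually.of_forall fun n h => absurd hk h
    have hc : Tendsto (fun x => ‖A k x‖) (𝓝 x₀) (𝓝 ‖A k x₀‖) := (A k).continuous.norm.tendsto x₀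
    filter_upwards [(A k).continuous.continuousAt.eventually_ne (h k hk).1,
      hc.eventually (h k hk).2.1] with x h1 h2 _ using ⟨h1, h2⟩
  filter_upwards [this] with x hx using pderiv_penSum hx j

/-- One part of the Hessian carries q'' = o_P(n); the other carries q' = O_P(√n) times the fixed
second derivative of a norm. -/
lemma RegularPenaltyAt.tendsto_hessMatrix_div (h : RegularPenaltyAt P N₀ q)
    (hN : ∀ k, ‖A k x₀‖ = N₀ k) (hA : ∀ k, N₀ k = 0 → A k = 0) (i j : ι) :
    Tendsto (fun p : ℕ × Ω => hessMatrix (fun y => ∑ k, q k p.1 p.2 ‖A k y‖) x₀ i j / p.1)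
      (whp P) (𝓝 0) := by
  classical
  refine tendsto_whp_zero_of_abs_le (X := fun n ω =>
    hessMatrix (fun y => ∑ k, q k n ω ‖A k y‖) x₀ i j / n) fun ε hε => ?_
  refine h.eventually_of_first_deriv (Q := fun n ω =>
    |hessMatrix (fun y => ∑ k, q k n ω ‖A k y‖) x₀ i j / n| ≤ ε) fun B hB => ?_
  set w := EuclideanSpace.single i (1 : ℝ)
  set w' := EuclideanSpace.single j (1 : ℝ)
  set W : ℝ := ∑ k, ‖A k w‖ * ‖A k w'‖ with hW
  set R : ℝ := ∑ k, |lineDeriv ℝ (normDir (A k) w') x₀ w| with hR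
  have hW0 : 0 ≤ W := by positivity
  have hR0 : 0 ≤ R := by positivity
  set e : ℝ := ε / (2 * (W + 1)) with he
  have he0 : 0 < e := by positivity
  filter_upwards [h.eventually_local one_pos he0, (tendsto_fst_whp P).eventually
    ((tendsto_div_sqrt_nat (B * R)).eventually_lt_const (half_pos hε)),
    (tendsto_fst_whp P).eventually (eventually_gt_atTop 0)] with p hp hRp hn hB'
  have hs : (0 : ℝ) < √p.1 := Real.sqrt_pos.2 (by exact_mod_cast hn)
  have hp0 : ∀ k, A k ≠ 0 → TwiceDifferentiableAt (q k p.1 p.2) ‖A k x₀‖ ∧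
      |deriv (deriv (q k p.1 p.2)) ‖A k x₀‖| ≤ e * p.1 := fun k hk =>
    hp k (fun h => hk (hA k h)) _ (by rw [hN k, sub_self, abs_zero]; positivity)
  have hx0 : ∀ k, A k ≠ 0 → A k x₀ ≠ 0 := fun k hk h0 =>
    hk (hA k (by rw [← hN k, h0, norm_zero]))
  rw [hessMatrix_penSum fun k hk => ⟨hx0 k hk, (hp0 k hk).1⟩, abs_div, Nat.abs_cast,
    div_le_iff₀ (by exact_mod_cast hn)]
  refine (abs_lineDeriv_penGrad_le (fun k hk => ⟨hx0 k hk, (hp0 k hk).1.2⟩) _ _).trans ?_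
  calc (∑ k, if A k = 0 then 0 else
        |deriv (deriv (q k p.1 p.2)) ‖A k x₀‖| * (‖A k w‖ * ‖A k w'‖) +
          |deriv (q k p.1 p.2) ‖A k x₀‖| * |lineDeriv ℝ (normDir (A k) w') x₀ w|)
      ≤ ∑ k, (e * p.1 * (‖A k w‖ * ‖A k w'‖) +
          B * √p.1 * |lineDeriv ℝ (normDir (A k) w') x₀ w|) := by
        refine Finset.sum_le_sum fun k _ => ?_
        split_ifs with hk
        · positivity
        have h5 := hB' k fun h => hk (hA k h)
        rw [← hN k] at h5
        gcongr
        exact (hp0 k hk).2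
    _ = (e * W + B * R / √p.1) * p.1 := by
        rw [Finset.sum_add_distrib, ← Finset.mul_sum, ← Finset.mul_sum, ← hW, ← hR, add_mul,
          mul_right_comm]
        congr 1
        rw [div_mul_eq_mul_div, eq_div_iff hs.ne']
        linear_combination (-(B * R)) * natCast_eq_sqrt_mul_sqrt p.1
    _ ≤ ε * p.1 := by
        gcongr
        have h1 : e * W ≤ ε / 2 := by
          rw [he, div_mul_eq_mul_div, div_le_div_iff₀ (by positivity) (by positivity)]
          nlinarith
        linarith

end Hessian

end PenaltyAsymptotics

/-! ### The deterministic sparsity argument -/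

section Sparsity

variable {κ : Type*} [Fintype κ] {F : Type*} [NormedAddCommGroup F] [InnerProductSpace ℝ F]

open Classical in
/-- If the terms `q k` with `N₀ k = 0` decrease steeply along `w` compared with the remaining part
of the objective, a local maximizer annihilates their arguments. -/
lemma sum_norm_eq_zero_of_isLocalMax {E : Type*} [NormedAddCommGroup E] [NormedSpace ℝ E]
    {L : E → ℝ} {A : κ → E →L[ℝ] F} {q : κ → ℝ → ℝ} {N₀ : κ → ℝ} {x w : E} {s : Set E}
    (hs : s ∈ 𝓝 x) {G a c : ℝ} {H : κ → ℝ} (hG : 0 ≤ G) (hH : ∀ k, 0 ≤ H k)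
    (hL : ∀ y ∈ s, |L y - L x| ≤ G * ‖y - x‖)
    (hZ : ∀ k, N₀ k = 0 → A k w = A k x)
    (hqZ : ∀ k, N₀ k = 0 → ∀ t, 0 ≤ t → t ≤ 1 →
      q k ((1 - t) * ‖A k x‖) ≤ q k ‖A k x‖ - t * ‖A k x‖ * a)
    (hq : ∀ k, N₀ k ≠ 0 → ∀ y ∈ s, |q k ‖A k y‖ - q k ‖A k x‖| ≤ H k * ‖y - x‖)
    (hw : ‖w‖ ≤ c * ∑ k, if N₀ k = 0 then ‖A k x‖ else 0)
    (ha : (G + ∑ k, H k) * c < a)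
    (hmax : IsLocalMax (fun y => L y - ∑ k, q k ‖A k y‖) x) :
    (∑ k, if N₀ k = 0 then ‖A k x‖ else 0) = 0 := by
  set d := ∑ k, if N₀ k = 0 then ‖A k x‖ else 0 with hd
  have hd0 : 0 ≤ d := Finset.sum_nonneg fun k _ => by split_ifs <;> positivity
  by_contra hne
  have hdpos : 0 < d := lt_of_le_of_ne hd0 (Ne.symm hne)
  have hcont : Tendsto (fun t : ℝ => x - t • w) (𝓝 0) (𝓝 x) := by
    have : Continuous fun t : ℝ => x - t • w := by fun_prop
    simpa using this.tendsto 0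
  -- A single small positive `t` suffices: values are compared, and nothing is differentiated where
  -- an argument may vanish.
  have hev : ∀ᶠ t : ℝ in 𝓝[>] 0, x - t • w ∈ s ∧
      L (x - t • w) - ∑ k, q k ‖A k (x - t • w)‖ ≤ L x - ∑ k, q k ‖A k x‖ ∧ 0 < t ∧ t < 1 := by
    filter_upwards [(hcont.eventually hs).filter_mono nhdsWithin_le_nhds,
      (hcont.eventually hmax).filter_mono nhdsWithin_le_nhds,
      Ioo_mem_nhdsGT (zero_lt_one' ℝ)] with t h1 h2 h3 using ⟨h1, h2, h3.1, h3.2⟩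
  obtain ⟨t, hts, hle, ht0, ht1⟩ := hev.exists
  have hnorm : ‖x - t • w - x‖ = t * ‖w‖ := by
    rw [sub_sub_cancel_left, norm_neg, norm_smul, Real.norm_of_nonneg ht0.le]
  have h1 := hL _ hts
  rw [hnorm] at h1
  have h2 : ∑ k, q k ‖A k (x - t • w)‖ ≤
      ∑ k, (q k ‖A k x‖ + H k * (t * ‖w‖) - t * a * if N₀ k = 0 then ‖A k x‖ else 0) := by
    refine Finset.sum_le_sum fun k _ => ?_
    split_ifs with hk
    · have h3 : ‖A k (x - t • w)‖ = (1 - t) * ‖A k x‖ := by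
        rw [map_sub, map_smul, hZ k hk]
        nth_rewrite 1 [← one_smul ℝ (A k x)]
        rw [← sub_smul, norm_smul, Real.norm_of_nonneg (by linarith)]
      rw [h3]
      have h4 : 0 ≤ H k * (t * ‖w‖) := mul_nonneg (hH k) (by positivity)
      linarith [hqZ k hk t ht0.le ht1.le]
    · have h3 := hq k hk _ hts
      rw [hnorm] at h3
      linarith [le_abs_self (q k ‖A k (x - t • w)‖ - q k ‖A k x‖)]
  rw [Finset.sum_sub_distrib, Finset.sum_add_distrib, ← Finset.sum_mul, ← Finset.mul_sum,
    ← hd] at h2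
  have h5 := (abs_le.1 h1).1
  -- Maximality forces the saving in the steep terms to be at most the possible loss elsewhere;
  -- since `‖w‖ ≤ c * d`, this contradicts `ha` unless `d = 0`.
  have h6 : t * a * d ≤ (G + ∑ k, H k) * (t * ‖w‖) := by linarith
  have hGH : 0 ≤ G + ∑ k, H k := add_nonneg hG (Finset.sum_nonneg fun k _ => hH k)
  have h7 : (G + ∑ k, H k) * (t * ‖w‖) ≤ (G + ∑ k, H k) * (t * (c * d)) := by gcongr
  have h8 : (G + ∑ k, H k) * c * (t * d) < a * (t * d) := by gcongr
  linarith

end Sparsity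

/-! ### Lipschitz bound for the log-likelihood -/

section LogLikelihood

variable {D g : ℕ} {τ : ℝ} {Φ₀ : Par D g} {Ω : Type*} {V : ℕ → Ω → Obs D} {M : Obs D → ℝ}
  {r : ℝ} {n : ℕ} {ω : Ω}

lemma differentiableAt_logLik (h : ∀ k, SmoothOnBall τ Φ₀ r (V k ω) (M (V k ω))) {Φ : Par D g}
    (hΦ : Φ ∈ Metric.ball Φ₀ r) : DifferentiableAt ℝ (logLik τ V n ω) Φ := by
  have : logLik τ V n ω = fun Φ : Par D g => ∑ k ∈ Finset.range n, logDensity τ (V k ω) Φ := rfl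
  rw [this]
  exact DifferentiableAt.fun_sum fun k _ => (h k).differentiableAt hΦ

lemma pderiv_logLik (h : ∀ k, SmoothOnBall τ Φ₀ r (V k ω) (M (V k ω))) {Φ : Par D g}
    (hΦ : Φ ∈ Metric.ball Φ₀ r) (i : ParIdx D g) :
    pderiv i (logLik τ V n ω) Φ = ∑ k ∈ Finset.range n, pderiv i (logDensity τ (V k ω)) Φ :=
  HasLineDerivAt.lineDeriv <| HasDerivAt.fun_sum
    (A := fun k t => logDensity τ (V k ω) (Φ + t • EuclideanSpace.single i 1)) fun k _ =>
      ((h k).differentiableAt hΦ).lineDifferentiableAt.hasLineDerivAt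

/-- The gradient in the small ball is the score at the centre plus the effect of bounded second
derivatives over a distance `η`. With `B` of order √n, `B'` of order n and `η` of order n^{-1/2} the
constant is of order √n. -/
lemma abs_logLik_sub_le (h : ∀ k, SmoothOnBall τ Φ₀ r (V k ω) (M (V k ω))) {B B' η : ℝ}
    (hη : η ≤ r) (hB : 0 ≤ B)
    (hS : ∀ i, |∑ k ∈ Finset.range n, pderiv i (logDensity τ (V k ω)) Φ₀| ≤ B)
    (hM : ∑ k ∈ Finset.range n, M (V k ω) ≤ B') {Φ Φ' : Par D g} (hΦ : Φ ∈ Metric.ball Φ₀ η)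
    (hΦ' : Φ' ∈ Metric.ball Φ₀ η) :
    |logLik τ V n ω Φ' - logLik τ V n ω Φ| ≤
      Fintype.card (ParIdx D g) * (B + Fintype.card (ParIdx D g) * B' * η) * ‖Φ' - Φ‖ := by
  have hη0 : 0 < η := Metric.pos_of_mem_ball hΦ
  have hB' : 0 ≤ B' := (Finset.sum_nonneg fun k _ => (h k).nonneg).trans hM
  have hsub : Metric.ball Φ₀ η ⊆ Metric.ball Φ₀ r := Metric.ball_subset_ball hη
  refine abs_sub_le_of_pderiv_le (convex_ball Φ₀ η)
    (fun z hz => differentiableAt_logLik h (hsub hz)) (by positivity) (fun z hz i => ?_) hΦ hΦ'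
  rw [pderiv_logLik h (hsub hz)]
  calc |∑ k ∈ Finset.range n, pderiv i (logDensity τ (V k ω)) z|
      = |∑ k ∈ Finset.range n, pderiv i (logDensity τ (V k ω)) Φ₀ +
          ∑ k ∈ Finset.range n, (pderiv i (logDensity τ (V k ω)) z -
            pderiv i (logDensity τ (V k ω)) Φ₀)| := by
        rw [Finset.sum_sub_distrib]; ring_nf
    _ ≤ B + ∑ k ∈ Finset.range n, Fintype.card (ParIdx D g) * M (V k ω) * η := by
        refine (abs_add_le _ _).trans (add_le_add (hS i) ((Finset.abs_sum_le_sum_abs _ _).trans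
          (Finset.sum_le_sum fun k _ => ?_)))
        refine ((h k).abs_score_sub_le (hsub hz) i).trans ?_
        have := (h k).nonneg
        gcongr
        exact (mem_ball_iff_norm.1 hz).le
    _ ≤ B + Fintype.card (ParIdx D g) * B' * η := by
        rw [← Finset.sum_mul, ← Finset.mul_sum]
        gcongr

end LogLikelihood

/-! ### Vanishing penalty arguments with high probability -/

section SparsityAsymptotics

variable {D g : ℕ} {τ : ℝ} {Φ₀ : Par D g} {Ω : Type*} [MeasurableSpace Ω] {P : Measure Ω}
  {V : ℕ → Ω → Obs D} {M : Obs D → ℝ} {r : ℝ}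
  {κ : Type*} [Fintype κ] {F : Type*} [NormedAddCommGroup F] [InnerProductSpace ℝ F]
  {N₀ : κ → ℝ} {q : κ → ℕ → Ω → ℝ → ℝ} {A : κ → Par D g →L[ℝ] F}

open Classical in
-- With all O_P(1) quantities frozen at constants, the non-steep part of the objective has Lipschitz
-- constant at most a fixed multiple of √n, and the steep slopes can be taken above `c` times it.
lemma eventually_map_eq_zero (hr : 0 < r)
    (hsmooth : ∀ᵐ ω ∂P, ∀ k, SmoothOnBall τ Φ₀ r (V k ω) (M (V k ω)))
    (hscore : ∀ i, BoundedInProb P fun n ω =>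
      (√n)⁻¹ * ∑ k ∈ Finset.range n, pderiv i (logDensity τ (V k ω)) Φ₀)
    (hM : BoundedInProb P fun n ω => (∑ k ∈ Finset.range n, M (V k ω)) / n)
    (hq : RegularPenaltyAt P N₀ q) (hN : ∀ k, ‖A k Φ₀‖ = N₀ k) {c : ℝ}
    (hdir : ∀ Φ : Par D g, ∃ w : Par D g, (∀ k, N₀ k = 0 → A k w = A k Φ) ∧
      ‖w‖ ≤ c * ∑ k, if N₀ k = 0 then ‖A k Φ‖ else 0)
    {X : ℕ → Ω → Par D g} (hX : BoundedInProb P fun n ω => √n * ‖X n ω - Φ₀‖)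
    (hmax : ∀ᶠ p in whp P, IsLocalMax (fun Φ => logLik τ V p.1 p.2 Φ -
      ∑ k, q k p.1 p.2 ‖A k Φ‖) (X p.1 p.2)) :
    ∀ᶠ p in whp P, ∀ k, N₀ k = 0 → A k (X p.1 p.2) = 0 := by
  refine eventually_whp_of_sqrt_mul_norm hX (Q := fun n ω => ∀ k, N₀ k = 0 → A k (X n ω) = 0)
    fun a ha => ?_
  refine hq.eventually_of_first_deriv (Q := fun n ω => ‖X n ω - Φ₀‖ ≤ a / √n →
    ∀ k, N₀ k = 0 → A k (X n ω) = 0) fun B hB => ?_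
  refine eventually_whp_of_bounded hM (Q := fun n ω => (∀ k, N₀ k ≠ 0 →
    |deriv (q k n ω) (N₀ k)| ≤ B * √n) → ‖X n ω - Φ₀‖ ≤ a / √n →
    ∀ k, N₀ k = 0 → A k (X n ω) = 0) fun B₁ => ?_
  refine eventually_whp_of_bounded (boundedInProb_sum_abs Finset.univ fun i _ => hscore i)
    (Q := fun n ω => |(∑ k ∈ Finset.range n, M (V k ω)) / n| ≤ B₁ → (∀ k, N₀ k ≠ 0 →
    |deriv (q k n ω) (N₀ k)| ≤ B * √n) → ‖X n ω - Φ₀‖ ≤ a / √n →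
    ∀ k, N₀ k = 0 → A k (X n ω) = 0) fun B₂ => ?_
  -- `C / √n` bounds the displacement of every penalty argument on the ball of radius `(a + 1) /
  -- √n`; the extra 1 in the radius places the estimator inside this open ball.
  set C : ℝ := ∑ k, ‖A k‖ * (a + 1) + 1 with hC
  have hC0 : 0 < C := by positivity
  have hAC : ∀ k, ‖A k‖ * (a + 1) < C := fun k => by
    have := Finset.single_le_sum (f := fun k => ‖A k‖ * (a + 1)) (fun _ _ => by positivity)
      (Finset.mem_univ k)
    linarith
  -- `G₀` and `H₀ k` are the Lipschitz constants of the log-likelihood and of the terms with nonzero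
  -- true argument, divided by √n.
  set G₀ : ℝ := Fintype.card (ParIdx D g) *
    (|B₂| + Fintype.card (ParIdx D g) * |B₁| * (a + 1)) with hG₀
  have hG₀0 : 0 ≤ G₀ := by positivity
  set H₀ : κ → ℝ := fun k => (B + C) * ‖A k‖ with hH₀
  -- Steepness is assumed up to `log n / √n`, which eventually exceeds the range `C / √n` of the
  -- arguments.
  have hlog : ∀ᶠ n : ℕ in atTop, C < Real.log n :=
    (Real.tendsto_log_atTop.comp tendsto_natCast_atTop_atTop).eventually_gt_atTop C
  filter_upwards [hmax, eventually_whp_of_ae fun _ => hsmooth,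
    hq.eventually_steep ((G₀ + ∑ k, H₀ k) * c + 1), hq.eventually_local hC0 one_pos,
    (tendsto_fst_whp P).eventually hlog, (tendsto_fst_whp P).eventually
    ((tendsto_div_sqrt_nat (a + 1)).eventually_lt_const hr),
    (tendsto_fst_whp P).eventually (eventually_gt_atTop 0)] with
    p hmax hsm hst hloc hlog hrn hn hS hMp hder hXp
  have hn' : (0 : ℝ) < p.1 := by exact_mod_cast hn
  have hs : (0 : ℝ) < √p.1 := Real.sqrt_pos.2 hn'
  have hss := natCast_eq_sqrt_mul_sqrt p.1
  obtain ⟨w, hwA, hw⟩ := hdir (X p.1 p.2)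
  set η := (a + 1) / √p.1 with hη
  have hXη : X p.1 p.2 ∈ Metric.ball Φ₀ η := by
    rw [mem_ball_iff_norm]
    exact hXp.trans_lt (by rw [hη]; gcongr; linarith)
  have hNle : ∀ k, ∀ y ∈ Metric.ball Φ₀ η, |‖A k y‖ - N₀ k| ≤ ‖A k‖ * (a + 1) / √p.1 := by
    intro k y hy
    rw [← hN k]
    calc |‖A k y‖ - ‖A k Φ₀‖| ≤ ‖A k y - A k Φ₀‖ := abs_norm_sub_norm_le _ _
      _ ≤ ‖A k‖ * ‖y - Φ₀‖ := by rw [← map_sub]; exact (A k).le_opNorm _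
      _ ≤ ‖A k‖ * η := by gcongr; exact (mem_ball_iff_norm.1 hy).le
      _ = _ := by rw [hη]; ring
  have hNC : ∀ k, ∀ y ∈ Metric.ball Φ₀ η, |‖A k y‖ - N₀ k| ≤ C / √p.1 := fun k y hy =>
    (hNle k y hy).trans (by gcongr; exact (hAC k).le)
  have key := sum_norm_eq_zero_of_isLocalMax (L := logLik τ V p.1 p.2) (A := A)
    (q := fun k => q k p.1 p.2) (N₀ := N₀) (x := X p.1 p.2) (w := w) (s := Metric.ball Φ₀ η)
    (Metric.isOpen_ball.mem_nhds hXη) (G := G₀ * √p.1)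
    (a := ((G₀ + ∑ k, H₀ k) * c + 1) * √p.1) (c := c) (H := fun k => H₀ k * √p.1)
    (by positivity) (fun k => by positivity) ?_ hwA ?_ ?_ hw ?_ hmax
  · intro k hk
    have := (Finset.sum_eq_zero_iff_of_nonneg fun k _ => by split_ifs <;> positivity).1 key k
      (Finset.mem_univ k)
    rw [if_pos hk] at this
    exact norm_eq_zero.1 this
  · intro y hy
    refine (abs_logLik_sub_le hsm hrn.le (B := |B₂| * √p.1) (B' := |B₁| * p.1) (by positivity)
      (fun i => ?_) ?_ hXη hy).trans (le_of_eq ?_)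
    · rw [abs_of_nonneg (Finset.sum_nonneg fun _ _ => abs_nonneg _)] at hS
      have h1 := (Finset.single_le_sum (f := fun i => |(√p.1)⁻¹ * ∑ k ∈ Finset.range p.1,
        pderiv i (logDensity τ (V k p.2)) Φ₀|) (fun _ _ => abs_nonneg _)
        (Finset.mem_univ i)).trans (hS.trans (le_abs_self B₂))
      rw [abs_mul, abs_of_pos (inv_pos.2 hs), inv_mul_le_iff₀ hs] at h1
      linarith
    · have h1 := (le_abs_self _).trans (hMp.trans (le_abs_self B₁))
      exact (div_le_iff₀ hn').1 h1
    · have h1 : (p.1 : ℝ) * η = (a + 1) * √p.1 := by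
        rw [hη, mul_div_assoc', div_eq_iff hs.ne']
        linear_combination (a + 1) * hss
      rw [hG₀]
      linear_combination (Fintype.card (ParIdx D g) * Fintype.card (ParIdx D g) * |B₁| *
        ‖y - X p.1 p.2‖) * h1
  · intro k hk t ht0 ht1
    obtain ⟨S, hS, hd⟩ := hq.twice_diff k p.1 p.2
    refine (hq.concave k p.1 p.2).le_sub_mul_of_le_deriv hS hd (fun s h0 hs hd => hst k hk s h0 hs hd)
      (norm_nonneg _) ?_ ht0 ht1
    have h1 := (le_abs_self _).trans (hNC k _ hXη)
    rw [hk, sub_zero] at h1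
    exact h1.trans_lt (by gcongr)
  · intro k hk y hy
    have h1 := abs_sub_le_of_twiceDifferentiable (b := 1 * p.1) (by positivity) (by positivity)
      (hloc k hk) (hNC k _ hXη) (hNC k y hy)
    refine h1.trans ?_
    have h2 : |‖A k y‖ - ‖A k (X p.1 p.2)‖| ≤ ‖A k‖ * ‖y - X p.1 p.2‖ :=
      (abs_norm_sub_norm_le _ _).trans (by rw [← map_sub]; exact (A k).le_opNorm _)
    have h3 : 1 * (p.1 : ℝ) * (C / √p.1) = C * √p.1 := by
      rw [mul_div_assoc', div_eq_iff hs.ne']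
      linear_combination C * hss
    rw [h3]
    calc (|deriv (q k p.1 p.2) (N₀ k)| + C * √p.1) * |‖A k y‖ - ‖A k (X p.1 p.2)‖|
        ≤ (B * √p.1 + C * √p.1) * (‖A k‖ * ‖y - X p.1 p.2‖) := by
          gcongr
          exact hder k hk
      _ = _ := by rw [hH₀]; ring
  · rw [← Finset.sum_mul, ← add_mul]
    nlinarith

end SparsityAsymptotics

/-! ### Scores and information under a linear reparametrization -/

section ReducedModel

variable {D g : ℕ} {τ : ℝ} {Φ₀ : Par D g} {μX : Measure (Fin D → ℝ)} {Θ : Set (Par D g)}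
  {ι : Type*}

lemma hasLineDerivAt_comp_clm [Fintype ι] {T : EuclideanSpace ℝ ι →L[ℝ] Par D g}
    {f : Par D g → ℝ} {ψ : EuclideanSpace ℝ ι}
    (hf : DifferentiableAt ℝ f (T ψ)) (w : EuclideanSpace ℝ ι) :
    HasLineDerivAt ℝ (fun y => f (T y)) (∑ i, T w i * pderiv i f (T ψ)) ψ w := by
  rw [← fderiv_apply_eq_sum_pderiv hf]
  exact (hf.hasFDerivAt.comp ψ T.hasFDerivAt).hasLineDerivAt w

variable [DecidableEq ι] {T : EuclideanSpace ℝ ι →L[ℝ] Par D g}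

/-- The score at the true parameter in the direction of the `j`-th coordinate of a linear
reparametrization `T`. -/
def dirScore (τ : ℝ) (Φ₀ : Par D g) (T : EuclideanSpace ℝ ι →L[ℝ] Par D g) (j : ι) (v : Obs D) :
    ℝ :=
  ∑ i, T (EuclideanSpace.single j 1) i * pderiv i (logDensity τ v) Φ₀

lemma clm_apply_coord_eq_sum [Fintype ι] (T : EuclideanSpace ℝ ι →L[ℝ] Par D g) (h : EuclideanSpace ℝ ι)
    (i : ParIdx D g) : T h i = ∑ j, h j * T (EuclideanSpace.single j 1) i :=
  clm_apply_eq_sum ((EuclideanSpace.proj i).comp T) h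

lemma RegularModel.memLp_dirScore (h : RegularModel τ μX Θ Φ₀) (hΦ₀ : Φ₀ ∈ interior Θ) (j : ι) :
    MemLp (dirScore τ Φ₀ T j) 2 (obsLaw τ μX Φ₀) :=
  memLp_finsetSum _ fun i _ => (h.memLp_score hΦ₀ i).const_mul _

lemma RegularModel.integral_dirScore [IsFiniteMeasure (obsLaw τ μX Φ₀)]
    (h : RegularModel τ μX Θ Φ₀) (hΦ₀ : Φ₀ ∈ interior Θ) (j : ι) :
    ∫ v, dirScore τ Φ₀ T j v ∂(obsLaw τ μX Φ₀) = 0 := by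
  unfold dirScore
  rw [integral_finsetSum _ fun i _ => ((h.memLp_score hΦ₀ i).integrable one_le_two).const_mul _]
  simp [integral_const_mul, h.score_mean]

/-- The information identity, transported by bilinearity to the directions of `T`. -/
lemma RegularModel.integral_dirScore_mul (h : RegularModel τ μX Θ Φ₀) (hΦ₀ : Φ₀ ∈ interior Θ)
    (j j' : ι) :
    ∫ v, dirScore τ Φ₀ T j v * dirScore τ Φ₀ T j' v ∂(obsLaw τ μX Φ₀) =
      -∑ i, ∑ i', T (EuclideanSpace.single j 1) i * T (EuclideanSpace.single j' 1) i' *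
        ∫ v, pderiv i' (pderiv i (logDensity τ v)) Φ₀ ∂(obsLaw τ μX Φ₀) := by
  unfold dirScore
  simp_rw [Finset.sum_mul_sum]
  have hi : ∀ i i', Integrable (fun v => T (EuclideanSpace.single j 1) i *
      pderiv i (logDensity τ v) Φ₀ * (T (EuclideanSpace.single j' 1) i' *
      pderiv i' (logDensity τ v) Φ₀)) (obsLaw τ μX Φ₀) := fun i i' =>
    ((h.memLp_score hΦ₀ i).const_mul _).integrable_mul ((h.memLp_score hΦ₀ i').const_mul _)
  rw [integral_finsetSum _ fun i _ => integrable_finsetSum _ fun i' _ => hi i i',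
    ← Finset.sum_neg_distrib]
  refine Finset.sum_congr rfl fun i _ => ?_
  rw [integral_finsetSum _ fun i' _ => hi i i', ← Finset.sum_neg_distrib]
  refine Finset.sum_congr rfl fun i' _ => ?_
  have h1 := h.information_identity i' i
  rw [integral_neg] at h1
  rw [← mul_neg, ← h1, ← integral_const_mul]
  refine integral_congr_ae (Eventually.of_forall fun v => ?_)
  simp only
  ring

end ReducedModel

/-! ### Expansion of the likelihood equations -/

section Expansion

variable {D g : ℕ} {τ : ℝ} {Φ₀ : Par D g} {Ω : Type*} [MeasurableSpace Ω] {P : Measure Ω}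
  {V : ℕ → Ω → Obs D} {M : Obs D → ℝ} {r : ℝ}
  {κ : Type*} [Fintype κ] {F : Type*} [NormedAddCommGroup F] [InnerProductSpace ℝ F]
  {N₀ : κ → ℝ} {q : κ → ℕ → Ω → ℝ → ℝ} {ι : Type*} [Fintype ι] [DecidableEq ι]
  {T : EuclideanSpace ℝ ι →L[ℝ] Par D g} {ψ₀ : EuclideanSpace ℝ ι}
  {A : κ → EuclideanSpace ℝ ι →L[ℝ] F} {X : ℕ → Ω → EuclideanSpace ℝ ι}

/-- The remainder of the first-order Taylor expansion of the score of the sample. -/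
def scoreRem (τ : ℝ) (Φ₀ : Par D g) (V : ℕ → Ω → Obs D) (i : ParIdx D g) (n : ℕ) (ω : Ω)
    (Φ : Par D g) : ℝ :=
  ∑ k ∈ Finset.range n, (pderiv i (logDensity τ (V k ω)) Φ - pderiv i (logDensity τ (V k ω)) Φ₀ -
    ∑ j, (Φ - Φ₀) j * pderiv j (pderiv i (logDensity τ (V k ω))) Φ₀)

/-- The remainder is at most a constant times the sum of the `M (V k ω)`, which is O_P(n), times the
squared distance O_P(1/n). It is thus O_P(1), and o_P(√n). -/
lemma tendsto_scoreRem_div_sqrt (hr : 0 < r)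
    (hsmooth : ∀ᵐ ω ∂P, ∀ k, SmoothOnBall τ Φ₀ r (V k ω) (M (V k ω)))
    (hM : BoundedInProb P fun n ω => (∑ k ∈ Finset.range n, M (V k ω)) / n)
    {Y : ℕ → Ω → Par D g} (hY : BoundedInProb P fun n ω => √n * ‖Y n ω - Φ₀‖) (i : ParIdx D g) :
    Tendsto (fun p : ℕ × Ω => scoreRem τ Φ₀ V i p.1 p.2 (Y p.1 p.2) / √p.1) (whp P) (𝓝 0) := by
  refine tendsto_whp_zero_of_abs_le
    (X := fun n ω => scoreRem τ Φ₀ V i n ω (Y n ω) / √n) fun ε hε => ?_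
  refine eventually_whp_of_sqrt_mul_norm hY
    (Q := fun n ω => |scoreRem τ Φ₀ V i n ω (Y n ω) / √n| ≤ ε) fun a ha => ?_
  refine eventually_whp_of_bounded hM (Q := fun n ω => ‖Y n ω - Φ₀‖ ≤ a / √n →
    |scoreRem τ Φ₀ V i n ω (Y n ω) / √n| ≤ ε) fun B => ?_
  set d : ℝ := (Fintype.card (ParIdx D g) : ℝ) with hd
  filter_upwards [eventually_whp_of_ae fun _ => hsmooth, (tendsto_fst_whp P).eventually
    ((tendsto_div_sqrt_nat a).eventually_lt_const hr), (tendsto_fst_whp P).eventually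
    ((tendsto_div_sqrt_nat (d * d * |B| * a ^ 2)).eventually_lt_const hε),
    (tendsto_fst_whp P).eventually (eventually_gt_atTop 0)] with p hsm hrn hεn hn hMp hYp
  have hn' : (0 : ℝ) < p.1 := by exact_mod_cast hn
  have hs : (0 : ℝ) < √p.1 := Real.sqrt_pos.2 hn'
  have hss := natCast_eq_sqrt_mul_sqrt p.1
  have hball : Y p.1 p.2 ∈ Metric.ball Φ₀ r := mem_ball_iff_norm.2 (hYp.trans_lt hrn)
  have hMB : ∑ k ∈ Finset.range p.1, M (V k p.2) ≤ |B| * p.1 :=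
    (div_le_iff₀ hn').1 ((le_abs_self _).trans (hMp.trans (le_abs_self B)))
  rw [abs_div, abs_of_pos hs, div_le_iff₀ hs]
  calc |scoreRem τ Φ₀ V i p.1 p.2 (Y p.1 p.2)|
      ≤ ∑ k ∈ Finset.range p.1, d * (d * M (V k p.2)) * (a / √p.1) ^ 2 := by
        refine (Finset.abs_sum_le_sum_abs _ _).trans (Finset.sum_le_sum fun k _ => ?_)
        refine ((hsm k).abs_score_taylor_le hball i).trans ?_
        have := (hsm k).nonneg
        gcongr
    _ = d * d * (a / √p.1) ^ 2 * ∑ k ∈ Finset.range p.1, M (V k p.2) := by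
        rw [Finset.mul_sum]
        exact Finset.sum_congr rfl fun k _ => by ring
    _ ≤ d * d * (a / √p.1) ^ 2 * (|B| * p.1) := by gcongr
    _ = d * d * |B| * a ^ 2 / √p.1 * √p.1 := by
        rw [div_pow, Real.sq_sqrt hn'.le]
        field_simp
    _ ≤ ε * √p.1 := by gcongr

/-- The likelihood equations of a local maximizer, in the directions of a reparametrization. -/
lemma eventually_score_eq {ι : Type*} [Fintype ι] {T : EuclideanSpace ℝ ι →L[ℝ] Par D g}
    {ψ₀ : EuclideanSpace ℝ ι} {A : κ → EuclideanSpace ℝ ι →L[ℝ] F}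
    {X : ℕ → Ω → EuclideanSpace ℝ ι} (hr : 0 < r) (hT : T ψ₀ = Φ₀)
    (hsmooth : ∀ᵐ ω ∂P, ∀ k, SmoothOnBall τ Φ₀ r (V k ω) (M (V k ω)))
    (hq : RegularPenaltyAt P N₀ q) (hN : ∀ k, ‖A k ψ₀‖ = N₀ k) (hA : ∀ k, N₀ k = 0 → A k = 0)
    (hX : BoundedInProb P fun n ω => √n * ‖X n ω - ψ₀‖)
    (hmax : ∀ᶠ p in whp P, IsLocalMax (fun ψ => logLik τ V p.1 p.2 (T ψ) -
      ∑ k, q k p.1 p.2 ‖A k ψ‖) (X p.1 p.2)) :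
    ∀ᶠ p in whp P, ∀ w, ∑ i, T w i *
      ∑ k ∈ Finset.range p.1, pderiv i (logDensity τ (V k p.2)) (T (X p.1 p.2)) =
        penGrad A (fun k => q k p.1 p.2) w (X p.1 p.2) := by
  have hball : ∀ᶠ p in whp P, T (X p.1 p.2) ∈ Metric.ball Φ₀ r := by
    refine eventually_whp_of_sqrt_mul_norm hX (Q := fun n ω => T (X n ω) ∈ Metric.ball Φ₀ r)
      fun a _ => ?_
    filter_upwards [(tendsto_fst_whp P).eventually
      ((tendsto_div_sqrt_nat (‖T‖ * a)).eventually_lt_const hr)] with p hp hXp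
    rw [mem_ball_iff_norm, ← hT, ← map_sub]
    refine (T.le_opNorm _).trans_lt (lt_of_le_of_lt ?_ hp)
    rw [mul_div_assoc]
    gcongr
  filter_upwards [hball, hmax, eventually_whp_of_ae fun _ => hsmooth,
    hq.eventually_differentiableAt hN hA hX] with p hb hm hsm hd w
  have h1 := hasLineDerivAt_comp_clm (differentiableAt_logLik (n := p.1) hsm hb) w
  have h2 := hasLineDerivAt_penSum hd w
  have h3 : HasDerivAt (fun t : ℝ => logLik τ V p.1 p.2 (T (X p.1 p.2 + t • w)) -
      ∑ k, q k p.1 p.2 ‖A k (X p.1 p.2 + t • w)‖) _ 0 := HasDerivAt.fun_sub h1 h2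
  have h4 : IsLocalMax (fun t : ℝ => logLik τ V p.1 p.2 (T (X p.1 p.2 + t • w)) -
      ∑ k, q k p.1 p.2 ‖A k (X p.1 p.2 + t • w)‖) 0 := by
    have hc : Continuous fun t : ℝ => X p.1 p.2 + t • w := by fun_prop
    have h5 : Tendsto (fun t : ℝ => X p.1 p.2 + t • w) (𝓝 0) (𝓝 (X p.1 p.2)) := by
      simpa using hc.tendsto 0
    filter_upwards [h5.eventually hm] with t ht
    simpa using ht
  have h6 := h4.hasDerivAt_eq_zero h3
  rw [sub_eq_zero] at h6
  rw [← h6]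
  exact Finset.sum_congr rfl fun i _ => by rw [pderiv_logLik hsm hb]

/-- The statistic minus the normalized score is, by the likelihood equation, a sum of four
negligible parts: the error of the averaged Hessian and the penalty Hessian, each times O_P(1), the
variation of the penalty gradient, and the Taylor remainder. -/
lemma tendsto_expansion (hr : 0 < r) (hT : T ψ₀ = Φ₀)
    (hsmooth : ∀ᵐ ω ∂P, ∀ k, SmoothOnBall τ Φ₀ r (V k ω) (M (V k ω)))
    (hM : BoundedInProb P fun n ω => (∑ k ∈ Finset.range n, M (V k ω)) / n)
    (hq : RegularPenaltyAt P N₀ q) (hN : ∀ k, ‖A k ψ₀‖ = N₀ k) (hA : ∀ k, N₀ k = 0 → A k = 0)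
    (hX : BoundedInProb P fun n ω => √n * ‖X n ω - ψ₀‖)
    (hmax : ∀ᶠ p in whp P, IsLocalMax (fun ψ => logLik τ V p.1 p.2 (T ψ) -
      ∑ k, q k p.1 p.2 ‖A k ψ‖) (X p.1 p.2))
    {J : ParIdx D g → ParIdx D g → ℝ} {I : Matrix ι ι ℝ}
    (hJ : ∀ i' i, Tendsto (fun p : ℕ × Ω => (∑ k ∈ Finset.range p.1,
      pderiv i' (pderiv i (logDensity τ (V k p.2))) Φ₀) / p.1) (whp P) (𝓝 (J i' i)))
    (hI : ∀ j j', I j j' = -∑ i, ∑ i', T (EuclideanSpace.single j 1) i *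
      T (EuclideanSpace.single j' 1) i' * J i' i) (j : ι) :
    Tendsto (fun p : ℕ × Ω => √p.1 * (∑ j', (I j j' - 1 / (p.1 : ℝ) *
        hessMatrix (fun y => ∑ k, q k p.1 p.2 ‖A k y‖) ψ₀ j j') * (X p.1 p.2 - ψ₀) j' +
        1 / (p.1 : ℝ) * gradVec (fun y => ∑ k, q k p.1 p.2 ‖A k y‖) ψ₀ j) -
      (√p.1)⁻¹ * ∑ k ∈ Finset.range p.1, dirScore τ Φ₀ T j (V k p.2)) (whp P) (𝓝 0) := by
  set H : ℕ → Ω → ParIdx D g → ParIdx D g → ℝ := fun n ω i' i => ∑ k ∈ Finset.range n,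
      pderiv i' (pderiv i (logDensity τ (V k ω))) Φ₀ with hH
  set t : ι → ParIdx D g → ℝ := fun j i => T (EuclideanSpace.single j 1) i with ht
  have hcoord : ∀ j', BoundedInProb P fun n ω => √n * (X n ω - ψ₀) j' := fun j' => by
    refine hX.of_abs_le_mul (a := 1) fun n ω => ?_
    rw [abs_mul, abs_mul, abs_norm, one_mul]
    gcongr
    exact PiLp.norm_apply_le (X n ω - ψ₀) j'
  have hY : BoundedInProb P fun n ω => √n * ‖T (X n ω) - Φ₀‖ := by
    refine hX.of_abs_le_mul (a := ‖T‖) fun n ω => ?_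
    rw [abs_mul, abs_mul, abs_norm, abs_norm, ← hT, ← map_sub, mul_left_comm]
    gcongr
    exact T.le_opNorm _
  have hD : ∀ j', Tendsto (fun p : ℕ × Ω => I j j' +
      ∑ i, ∑ i', t j i * t j' i' * (H p.1 p.2 i' i / p.1)) (whp P) (𝓝 0) := fun j' => by
    have h1 : Tendsto (fun p : ℕ × Ω => I j j' +
      ∑ i, ∑ i', t j i * t j' i' * (H p.1 p.2 i' i / p.1)) (whp P)
      (𝓝 (I j j' + ∑ i, ∑ i', t j i * t j' i' * J i' i)) :=
      tendsto_const_nhds.add (tendsto_finsetSum _ fun i _ => tendsto_finsetSum _ fun i' _ =>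
        (hJ i' i).const_mul _)
    have h0 : I j j' + ∑ i, ∑ i', t j i * t j' i' * J i' i = 0 := by
      rw [hI j j']
      exact neg_add_cancel _
    rwa [h0] at h1
  have hlim : Tendsto (fun p : ℕ × Ω =>
      ((∑ j', √p.1 * (X p.1 p.2 - ψ₀) j' *
        (I j j' + ∑ i, ∑ i', t j i * t j' i' * (H p.1 p.2 i' i / p.1))) -
      (∑ j', √p.1 * (X p.1 p.2 - ψ₀) j' *
        (hessMatrix (fun y => ∑ k, q k p.1 p.2 ‖A k y‖) ψ₀ j j' / p.1))) -
      (penGrad A (fun k => q k p.1 p.2) (EuclideanSpace.single j 1) (X p.1 p.2) -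
        penGrad A (fun k => q k p.1 p.2) (EuclideanSpace.single j 1) ψ₀) / √p.1 +
      ∑ i, t j i * (scoreRem τ Φ₀ V i p.1 p.2 (T (X p.1 p.2)) / √p.1)) (whp P) (𝓝 0) := by
    have h1 : ∀ j', Tendsto (fun p : ℕ × Ω => √p.1 * (X p.1 p.2 - ψ₀) j' * (I j j' +
        ∑ i, ∑ i', t j i * t j' i' * (H p.1 p.2 i' i / p.1))) (whp P) (𝓝 0) := fun j' =>
      (hcoord j').tendsto_mul_zero (Y := fun n ω => I j j' +
        ∑ i, ∑ i', t j i * t j' i' * (H n ω i' i / n)) (hD j')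
    have h2 : ∀ j', Tendsto (fun p : ℕ × Ω => √p.1 * (X p.1 p.2 - ψ₀) j' *
        (hessMatrix (fun y => ∑ k, q k p.1 p.2 ‖A k y‖) ψ₀ j j' / p.1)) (whp P) (𝓝 0) := fun j' =>
      (hcoord j').tendsto_mul_zero (Y := fun n ω =>
        hessMatrix (fun y => ∑ k, q k n ω ‖A k y‖) ψ₀ j j' / n)
        (hq.tendsto_hessMatrix_div hN hA j j')
    have h3 := hq.tendsto_penGrad_sub hN hA hX (EuclideanSpace.single j 1)
    have h4 : ∀ i, Tendsto (fun p : ℕ × Ω => t j i *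
        (scoreRem τ Φ₀ V i p.1 p.2 (T (X p.1 p.2)) / √p.1)) (whp P) (𝓝 (t j i * 0)) := fun i =>
      (tendsto_scoreRem_div_sqrt hr hsmooth hM hY i).const_mul (t j i)
    have h5 := (((tendsto_finsetSum Finset.univ fun j' _ => h1 j').sub
      (tendsto_finsetSum Finset.univ fun j' _ => h2 j')).sub h3).add
      (tendsto_finsetSum Finset.univ fun i _ => h4 i)
    simpa using h5
  -- The constant sequence makes the differentiability lemma available at `ψ₀` itself.
  have hconst : BoundedInProb P fun n (ω : Ω) => √n * ‖(fun _ _ => ψ₀) n ω - ψ₀‖ :=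
    fun ε _ => ⟨0, by simp⟩
  refine hlim.congr' ?_
  filter_upwards [eventually_score_eq hr hT hsmooth hq hN hA hX hmax,
    hq.eventually_differentiableAt (X := fun _ _ => ψ₀) hN hA hconst,
    (tendsto_fst_whp P).eventually (eventually_gt_atTop 0)] with p hsc hdiff hn
  have hn' : (0 : ℝ) < p.1 := by exact_mod_cast hn
  have hs : (0 : ℝ) < √p.1 := Real.sqrt_pos.2 hn'
  have hss := natCast_eq_sqrt_mul_sqrt p.1
  have hgrad : gradVec (fun y => ∑ k, q k p.1 p.2 ‖A k y‖) ψ₀ j =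
      penGrad A (fun k => q k p.1 p.2) (EuclideanSpace.single j 1) ψ₀ := pderiv_penSum hdiff j
  rw [hgrad]
  set h := X p.1 p.2 - ψ₀ with hh
  set G := penGrad A (fun k => q k p.1 p.2) (EuclideanSpace.single j 1) (X p.1 p.2)
  set G₀ := penGrad A (fun k => q k p.1 p.2) (EuclideanSpace.single j 1) ψ₀
  set Q := hessMatrix (fun y => ∑ k, q k p.1 p.2 ‖A k y‖) ψ₀
  set ρ : ParIdx D g → ℝ := fun i => scoreRem τ Φ₀ V i p.1 p.2 (T (X p.1 p.2)) with hρ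
  have hrem : ∀ i, ∑ k ∈ Finset.range p.1, pderiv i (logDensity τ (V k p.2)) (T (X p.1 p.2)) =
      ∑ k ∈ Finset.range p.1, pderiv i (logDensity τ (V k p.2)) Φ₀ +
        ∑ i', (∑ j', h j' * t j' i') * H p.1 p.2 i' i + ρ i := fun i => by
    have h1 : ∀ i', (T (X p.1 p.2) - Φ₀) i' = ∑ j', h j' * t j' i' := fun i' => by
      rw [← hT, ← map_sub]
      exact clm_apply_coord_eq_sum T h i'
    simp only [hρ, scoreRem, h1]
    rw [Finset.sum_sub_distrib, Finset.sum_sub_distrib, Finset.sum_comm (s := Finset.range p.1)]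
    simp only [hH, ← Finset.mul_sum]
    ring
  have hscore := hsc (EuclideanSpace.single j 1)
  simp only [hrem, mul_add, Finset.sum_add_distrib] at hscore
  have hS : ∑ k ∈ Finset.range p.1, dirScore τ Φ₀ T j (V k p.2) =
      ∑ i, t j i * ∑ k ∈ Finset.range p.1, pderiv i (logDensity τ (V k p.2)) Φ₀ := by
    unfold dirScore
    rw [Finset.sum_comm]
    simp only [ht, Finset.mul_sum]
  have hmid : ∑ i, t j i * ∑ i', (∑ j', h j' * t j' i') * H p.1 p.2 i' i =
      ∑ j', h j' * ∑ i, ∑ i', t j i * t j' i' * H p.1 p.2 i' i := by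
    simp only [Finset.mul_sum, Finset.sum_mul]
    rw [Finset.sum_comm (s := (Finset.univ : Finset ι))]
    refine Finset.sum_congr rfl fun i _ => ?_
    rw [Finset.sum_comm]
    exact Finset.sum_congr rfl fun j' _ => Finset.sum_congr rfl fun i' _ => by ring
  rw [hS]
  -- The likelihood equation solved for the score at the truth; what remains is algebra with powers
  -- of √n.
  have hS' : ∑ i, t j i * ∑ k ∈ Finset.range p.1, pderiv i (logDensity τ (V k p.2)) Φ₀ =
      G - ∑ j', h j' * ∑ i, ∑ i', t j i * t j' i' * H p.1 p.2 i' i - ∑ i, t j i * ρ i := by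
    rw [← hmid]
    linarith
  rw [hS']
  have e1 : ∑ j', √p.1 * h j' * (I j j' + ∑ i, ∑ i', t j i * t j' i' * (H p.1 p.2 i' i / p.1)) =
      √p.1 * ∑ j', I j j' * h j' +
        (√p.1)⁻¹ * ∑ j', h j' * ∑ i, ∑ i', t j i * t j' i' * H p.1 p.2 i' i := by
    have hinv : √p.1 / p.1 = (√p.1)⁻¹ := by
      rw [div_eq_iff hn'.ne', eq_inv_mul_iff_mul_eq₀ hs.ne', ← hss]
    simp only [mul_div_assoc', ← Finset.sum_div]
    rw [Finset.mul_sum, Finset.mul_sum, ← Finset.sum_add_distrib, ← hinv]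
    exact Finset.sum_congr rfl fun j' _ => by ring
  have e2 : ∑ j', √p.1 * h j' * (Q j j' / p.1) = √p.1 * (1 / p.1 * ∑ j', Q j j' * h j') := by
    rw [Finset.mul_sum, Finset.mul_sum]
    exact Finset.sum_congr rfl fun j' _ => by ring
  have e3 : ∑ i, t j i * (ρ i / √p.1) = (√p.1)⁻¹ * ∑ i, t j i * ρ i := by
    rw [Finset.mul_sum]
    exact Finset.sum_congr rfl fun j' _ => by ring
  have e4 : ∑ j', (I j j' - 1 / (p.1 : ℝ) * Q j j') * h j' =
      ∑ j', I j j' * h j' - 1 / p.1 * ∑ j', Q j j' * h j' := by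
    rw [Finset.mul_sum, ← Finset.sum_sub_distrib]
    exact Finset.sum_congr rfl fun j' _ => by ring
  have e5 : √p.1 * (1 / p.1) = (√p.1)⁻¹ := by
    rw [mul_one_div, div_eq_iff hn'.ne', eq_inv_mul_iff_mul_eq₀ hs.ne', ← hss]
  rw [e1, e2, e3, e4]
  linear_combination (-G₀) * e5

end Expansion

/-! ### Specialization to the transformed model -/

section TransformedModel

variable {D g : ℕ} {τ : ℝ} {Φ₀ : Par D g} {K : Fin 3 → ℕ} {c : ∀ l, Fin (K l) → Fin D → ℝ}
  {m : Fin 3 → ℕ} {C : Fin 3 → Matrix (Fin D) (Fin D) ℝ} {Ω : Type*}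
  {pen : Fin 3 → ℕ → Ω → ℝ → ℝ → ℝ} {lam : ∀ l, Fin (K l) → ℕ → Ω → ℝ}

lemma totalPenalty_eq_sum (n : ℕ) (ω : Ω) (Φ : Par D g) :
    totalPenalty c pen lam n ω Φ =
      ∑ k : Σ l, Fin (K l), pen k.1 n ω ‖penMap k.1 (c k.1 k.2) Φ‖ (lam k.1 k.2 n ω) := by
  simp_rw [totalPenalty, Fintype.sum_sigma, norm_penMap]

open Classical in
-- The vector `w` is the reduced part of `Φ*` mapped back. Removing it leaves zero reduced
-- coordinates, so the arguments to be killed agree on `w` and `Φ`; its norm is controlled because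
-- each reduced coordinate is bounded by one of those arguments.
lemma exists_scaling_direction (hC : ∀ l, IsReduction (c l) (zeroSet c Φ₀ l) (m l) (C l)) :
    ∃ b : ℝ, ∀ Φ : Par D g, ∃ w : Par D g,
      (∀ k : Σ l, Fin (K l), penArg k.1 (c k.1 k.2) Φ₀ = 0 →
        penMap k.1 (c k.1 k.2) w = penMap k.1 (c k.1 k.2) Φ) ∧
      ‖w‖ ≤ b * ∑ k : Σ l, Fin (K l),
        if penArg k.1 (c k.1 k.2) Φ₀ = 0 then ‖penMap k.1 (c k.1 k.2) Φ‖ else 0 := by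
  have hdet : ∀ l, IsUnit (C l).det := fun l => (hC l).full_rank
  set S : Par D g →L[ℝ] Par D g := linTransformL fun l => (C l)⁻¹ with hS
  refine ⟨‖S‖ * Fintype.card (ParIdx D g), fun Φ => ⟨S (redPart m (toStar C Φ)), fun k hk => ?_, ?_⟩⟩
  · rw [eq_comm, ← sub_eq_zero, ← map_sub]
    refine penMap_eq_zero_of_red_eq_zero hC (fun i hi => ?_) hk
    have h1 : toStar C (Φ - S (redPart m (toStar C Φ))) = toStar C Φ - redPart m (toStar C Φ) := by
      have h2 : toStar C (Φ - S (redPart m (toStar C Φ))) =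
        toStar C Φ - toStar C (fromStar C (redPart m (toStar C Φ))) := map_sub (linTransformL C) _ _
      rw [h2, toStar_fromStar hdet]
    rw [h1]
    simp [redPart, hi]
  · rw [mul_assoc]
    refine (S.le_opNorm _).trans (mul_le_mul_of_nonneg_left ?_ (norm_nonneg _))
    refine norm_redPart_le (Finset.sum_nonneg fun k _ => by split_ifs <;> positivity) fun i hi => ?_
    obtain ⟨l, k, hk, hle⟩ := exists_abs_red_le hC Φ hi
    refine hle.trans ?_
    have h1 := Finset.single_le_sum (f := fun k : Σ l, Fin (K l) =>
      if penArg k.1 (c k.1 k.2) Φ₀ = 0 then ‖penMap k.1 (c k.1 k.2) Φ‖ else 0)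
      (fun k _ => by split_ifs <;> positivity) (Finset.mem_univ ⟨l, k⟩)
    rw [if_pos (show penArg l (c l k) Φ₀ = 0 from hk), norm_penMap] at h1
    exact h1

/-- The reparametrization is a homeomorphism, and a constraint set that is a neighbourhood of the
point may be dropped. -/
lemma isLocalMax_of_isLocalMaxOn_star (hdet : ∀ l, IsUnit (C l).det) {f : Par D g → ℝ}
    {Θ : Set (Par D g)} {x : Par D g} (hx : Θ ∈ 𝓝 (fromStar C x))
    (h : IsLocalMaxOn (fun Φs => f (fromStar C Φs)) {Φs | fromStar C Φs ∈ Θ} x) :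
    IsLocalMax f (fromStar C x) := by
  have hc : Continuous (fromStar (D := D) (g := g) C) := (linTransformL fun l => (C l)⁻¹).continuous
  have h1 : IsLocalMax (fun Φs => f (fromStar C Φs)) x :=
    h.isLocalMax (hc.continuousAt.preimage_mem_nhds hx)
  have h2 : Tendsto (toStar C) (𝓝 (fromStar C x)) (𝓝 x) := by
    have h3 := (linTransformL (g := g) C).continuous.tendsto (fromStar C x)
    have h4 : linTransformL C (fromStar C x) = x := toStar_fromStar hdet x
    rwa [h4] at h3
  filter_upwards [h2.eventually h1] with Φ hΦ
  rwa [fromStar_toStar hdet] at hΦ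

lemma norm_indPart_sub_le (x y : Par D g) : ‖indPart m x - indPart m y‖ ≤ ‖x - y‖ := by
  rw [EuclideanSpace.norm_eq, EuclideanSpace.norm_eq]
  refine Real.sqrt_le_sqrt ?_
  have h := Fintype.sum_subtype_add_sum_subtype (IsRed m) fun i => ‖(x - y) i‖ ^ 2
  have h0 : 0 ≤ ∑ i : {i : ParIdx D g // IsRed m i}, ‖(x - y) i.1‖ ^ 2 := by positivity
  calc ∑ i, ‖(indPart m x - indPart m y) i‖ ^ 2
      = ∑ i : {i : ParIdx D g // ¬ IsRed m i}, ‖(x - y) i.1‖ ^ 2 := rfl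
    _ ≤ ∑ i, ‖(x - y) i‖ ^ 2 := by linarith

/-- The chain rule: reduced scores are linear combinations of full scores at `Φ₀`. -/
lemma fisherInfo_reduced {law : Measure (Obs D)} {r : ℝ} (hr : 0 < r) {M : Obs D → ℝ}
    (hs : ∀ᵐ v ∂law, SmoothOnBall τ Φ₀ r v (M v)) {ψ₀ : EuclideanSpace ℝ (IndIdx D g m)}
    (hT : reducedMap C m ψ₀ = Φ₀) :
    fisherInfo law (reducedLogDensity τ C m) ψ₀ = Matrix.of fun i j =>
      ∫ v, dirScore τ Φ₀ (reducedMap C m) i v * dirScore τ Φ₀ (reducedMap C m) j v ∂law := by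
  ext i j
  refine integral_congr_ae ?_
  filter_upwards [hs] with v hv
  have h : ∀ j, pderiv j (reducedLogDensity τ C m v) ψ₀ = dirScore τ Φ₀ (reducedMap C m) j v := by
    intro j
    have hd : DifferentiableAt ℝ (logDensity τ v) (reducedMap C m ψ₀) := by
      rw [hT]
      exact hv.differentiableAt (Metric.mem_ball_self hr)
    have := (hasLineDerivAt_comp_clm hd (EuclideanSpace.single j 1)).lineDeriv
    rw [hT] at this
    exact this
  rw [h, h]

end TransformedModel

end

/-! ### Sparsity and asymptotic normality -/

theorem theorem2 {D g : ℕ} {Ω : Type*} [MeasurableSpace Ω] (P : Measure Ω) [IsProbabilityMeasure P]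
    -- model, true parameter, and random sample
    (τ : ℝ) (hτ : 0 < τ) (μX : Measure (Fin D → ℝ)) [IsProbabilityMeasure μX]
    (Θ : Set (Par D g)) (hΘ : ∀ Φ ∈ Θ, (∀ j, 0 < Φ.phi j) ∧ 0 < Φ.theta)
    (Φ₀ : Par D g) (hΦ₀ : Φ₀ ∈ interior Θ)
    (hmodel : RegularModel τ μX Θ Φ₀)
    (V : ℕ → Ω → Obs D) (hV : ∀ i, Measurable (V i)) (hVindep : iIndepFun V P)
    (hVlaw : ∀ i, P.map (V i) = obsLaw τ μX Φ₀)
    -- penalties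
    (K : Fin 3 → ℕ) (c : ∀ l, Fin (K l) → Fin D → ℝ)
    (pen : Fin 3 → ℕ → Ω → ℝ → ℝ → ℝ) (lam : ∀ l, Fin (K l) → ℕ → Ω → ℝ)
    (hpen : RegularPenalty P c pen lam Φ₀)
    -- transformation of the parameter space
    (m : Fin 3 → ℕ) (C : Fin 3 → Matrix (Fin D) (Fin D) ℝ)
    (hC : ∀ l, IsReduction (c l) (zeroSet c Φ₀ l) (m l) (C l))
    (hgrad : ∀ n i, AEMeasurable (fun ω =>
      gradVec (reducedPenalty c pen lam C m n ω) (indPart m (toStar C Φ₀)) i) P)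
    (hhess : ∀ n i j, AEMeasurable (fun ω =>
      hessMatrix (reducedPenalty c pen lam C m n ω) (indPart m (toStar C Φ₀)) i j) P)
    -- a root-n consistent local maximizer, in the transformed parameter space
    (Φhat : ℕ → Ω → Par D g) (hΦhat : ∀ n, Measurable (Φhat n))
    (hmax : Tendsto (fun n => P {ω | ¬ (fromStar C (Φhat n ω) ∈ Θ ∧
      IsLocalMaxOn (fun Φs => penLogLik τ V c pen lam n ω (fromStar C Φs))
        {Φs | fromStar C Φs ∈ Θ} (Φhat n ω))}) atTop (𝓝 0))
    (hcons : BoundedInProb P fun n ω => √n * ‖Φhat n ω - toStar C Φ₀‖) :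
    Tendsto (fun n => P {ω | ∀ i, IsRed m i → Φhat n ω i = 0}) atTop (𝓝 1) ∧
    TendstoInDistribution
      (fun (n : ℕ) ω => WithLp.toLp 2 (√n •
        ((fisherInfo (obsLaw τ μX Φ₀) (reducedLogDensity τ C m) (indPart m (toStar C Φ₀))
            - (1 / (n : ℝ)) •
              hessMatrix (reducedPenalty c pen lam C m n ω) (indPart m (toStar C Φ₀))).mulVec
          (WithLp.ofLp (indPart m (Φhat n ω) - indPart m (toStar C Φ₀)))
        + (1 / (n : ℝ)) •
            gradVec (reducedPenalty c pen lam C m n ω) (indPart m (toStar C Φ₀)))))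
      atTop (id : EuclideanSpace ℝ (IndIdx D g m) → _) (fun _ => P)
      (multivariateGaussian 0
        (fisherInfo (obsLaw τ μX Φ₀) (reducedLogDensity τ C m) (indPart m (toStar C Φ₀)))) := by
  have hdet : ∀ l, IsUnit (C l).det := fun l => (hC l).full_rank
  obtain ⟨r, hr, hrΘ, M, hMint, hsm⟩ := hmodel.exists_smoothOnBall hΦ₀
  have hprob : IsProbabilityMeasure (obsLaw τ μX Φ₀) := by
    rw [← hVlaw 0]
    exact Measure.isProbabilityMeasure_map (hV 0).aemeasurable
  have hsmooth := ae_sample hV hVlaw hsm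
  have hM := boundedInProb_average hV hVlaw hMint
  have hq := hpen.regularPenaltyAt
  set q : (Σ l, Fin (K l)) → ℕ → Ω → ℝ → ℝ := fun k n ω s => pen k.1 n ω s (lam k.1 k.2 n ω)
  set N₀ : (Σ l, Fin (K l)) → ℝ := fun k => penArg k.1 (c k.1 k.2) Φ₀ with hN₀
  set ψ₀ := indPart m (toStar C Φ₀) with hψ₀
  have hT : reducedMap C m ψ₀ = Φ₀ := reducedMap_indPart_toStar hdet fun i hi => toStar_true_red hC hi
  have hcX : BoundedInProb P fun n ω => √n * ‖fromStar C (Φhat n ω) - Φ₀‖ := by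
    refine hcons.of_abs_le_mul (a := ‖linTransformL (D := D) (g := g) fun l => (C l)⁻¹‖) fun n ω => ?_
    have h1 : fromStar C (Φhat n ω) - Φ₀ =
        linTransformL (fun l => (C l)⁻¹) (Φhat n ω - toStar C Φ₀) := by
      rw [map_sub]
      exact congrArg _ (fromStar_toStar hdet Φ₀).symm
    rw [abs_mul, abs_mul, abs_norm, abs_norm, h1, mul_left_comm]
    gcongr
    exact ContinuousLinearMap.le_opNorm _ _
  have hmaxΦ : ∀ᶠ p in whp P, IsLocalMax (fun Φ => logLik τ V p.1 p.2 Φ -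
      ∑ k, q k p.1 p.2 ‖penMap k.1 (c k.1 k.2) Φ‖) (fromStar C (Φhat p.1 p.2)) := by
    -- Consistency puts the estimator in a ball inside `Θ`, so it is an unconstrained local
    -- maximizer.
    have hball : ∀ᶠ p in whp P, Θ ∈ 𝓝 (fromStar C (Φhat p.1 p.2)) := by
      refine eventually_whp_of_sqrt_mul_norm hcX (Q := fun n ω => Θ ∈ 𝓝 (fromStar C (Φhat n ω)))
        fun a _ => ?_
      filter_upwards [(tendsto_fst_whp P).eventually
        ((tendsto_div_sqrt_nat a).eventually_lt_const hr)] with p hp hXp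
      exact mem_of_superset (Metric.isOpen_ball.mem_nhds
        (mem_ball_iff_norm.2 (hXp.trans_lt hp))) hrΘ
    have hmax' : ∀ᶠ p in whp P, fromStar C (Φhat p.1 p.2) ∈ Θ ∧
      IsLocalMaxOn (fun Φs => penLogLik τ V c pen lam p.1 p.2 (fromStar C Φs))
        {Φs | fromStar C Φs ∈ Θ} (Φhat p.1 p.2) := hmax
    filter_upwards [hball, hmax'] with p h1 h2
    have h3 := isLocalMax_of_isLocalMaxOn_star hdet h1 h2.2
    have h4 : penLogLik τ V c pen lam p.1 p.2 = fun Φ : Par D g => logLik τ V p.1 p.2 Φ -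
        ∑ k, q k p.1 p.2 ‖penMap k.1 (c k.1 k.2) Φ‖ := by
      funext Φ
      rw [penLogLik, totalPenalty_eq_sum]
    rwa [h4] at h3
  have hred : ∀ᶠ p in whp P, ∀ i, IsRed m i → Φhat p.1 p.2 i = 0 := by
    obtain ⟨b, hb⟩ := exists_scaling_direction hC
    have hscore : ∀ i, BoundedInProb P fun n ω =>
        (√n)⁻¹ * ∑ k ∈ Finset.range n, pderiv i (logDensity τ (V k ω)) Φ₀ := fun i =>
      boundedInProb_inv_sqrt_mul_sum (f := fun v => pderiv i (logDensity τ v) Φ₀) hV hVindep hVlaw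
        (hmodel.memLp_score hΦ₀ i) (hmodel.score_mean i)
    have hzero := eventually_map_eq_zero (A := fun k : Σ l, Fin (K l) => penMap k.1 (c k.1 k.2))
      (N₀ := N₀) (q := q) (c := b) (X := fun n ω => fromStar C (Φhat n ω))
      hr hsmooth hscore hM hq (fun k => norm_penMap k.1 (c k.1 k.2) Φ₀) hb hcX hmaxΦ
    filter_upwards [hzero] with p hp i hi
    obtain ⟨l, k, hk, hle⟩ := exists_abs_red_le hC (fromStar C (Φhat p.1 p.2)) hi
    rw [toStar_fromStar hdet, ← norm_penMap, hp ⟨l, k⟩ hk, norm_zero] at hle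
    exact abs_eq_zero.1 (le_antisymm hle (abs_nonneg _))
  have hmeas : ∀ i, ∀ n, Measurable fun ω => Φhat n ω i := fun i n =>
    (EuclideanSpace.proj (𝕜 := ℝ) i).continuous.measurable.comp (hΦhat n)
  refine ⟨tendsto_measure_one_of_whp (fun n => ?_) hred, ?_⟩
  · simp only [ofPred_forall]
    exact MeasurableSet.iInter fun i => MeasurableSet.iInter fun _ =>
      measurableSet_eq_fun (hmeas i n) measurable_const
  set A : (Σ l, Fin (K l)) → EuclideanSpace ℝ (IndIdx D g m) →L[ℝ] EuclideanSpace ℝ (Fin g ⊕ Unit) :=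
    fun k => (penMap k.1 (c k.1 k.2)).comp (reducedMap C m) with hA
  have hpenred : ∀ n ω, reducedPenalty c pen lam C m n ω = fun ψ => ∑ k, q k n ω ‖A k ψ‖ :=
    fun n ω => funext fun ψ => totalPenalty_eq_sum n ω _
  have hA0 : ∀ k, N₀ k = 0 → A k = 0 := fun k hk =>
    ContinuousLinearMap.ext fun ψ => penMap_reducedMap hC hk ψ
  have hAN : ∀ k, ‖A k ψ₀‖ = N₀ k := fun k => by
    simp only [hA, ContinuousLinearMap.comp_apply, hT, norm_penMap, hN₀]
  have hcψ : BoundedInProb P fun n ω => √n * ‖indPart m (Φhat n ω) - ψ₀‖ := by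
    refine hcons.of_abs_le_mul (a := 1) fun n ω => ?_
    rw [abs_mul, abs_mul, abs_norm, abs_norm, one_mul]
    gcongr
    exact norm_indPart_sub_le _ _
  have hmaxψ : ∀ᶠ p in whp P, IsLocalMax (fun ψ => logLik τ V p.1 p.2 (reducedMap C m ψ) -
      ∑ k, q k p.1 p.2 ‖A k ψ‖) (indPart m (Φhat p.1 p.2)) := by
    -- Once its reduced coordinates vanish the estimator lies in the range of `reducedMap C m`, and
    -- maximality passes to this subspace by continuity.
    filter_upwards [hmaxΦ, hred] with p h1 h2
    have h3 : reducedMap C m (indPart m (Φhat p.1 p.2)) = fromStar C (Φhat p.1 p.2) := by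
      rw [reducedMap_apply, withZeroRed_indPart h2]
    rw [← h3] at h1
    exact (reducedMap C m).continuous.continuousAt.eventually h1
  have hfisher := fisherInfo_reduced (C := C) (m := m) hr hsm hT
  have hclt := tendstoInDistribution_inv_sqrt_mul_sum_pi hV hVindep hVlaw
    (f := dirScore τ Φ₀ (reducedMap C m)) (hmodel.memLp_dirScore hΦ₀)
    (hmodel.integral_dirScore hΦ₀)
  rw [← hfisher] at hclt
  set I := fisherInfo (obsLaw τ μX Φ₀) (reducedLogDensity τ C m) ψ₀ with hI
  -- Slutsky's lemma: the statistic differs from the normalized score by a term tending to zero in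
  -- probability.
  refine tendstoInDistribution_of_tendstoInMeasure_sub _ _ hclt ?_ fun n => ?_
  · have hcoord := tendsto_expansion hr hT hsmooth hM hq hAN hA0 hcψ hmaxψ
      (fun i' i => tendsto_whp_average (f := fun v => pderiv i' (pderiv i (logDensity τ v)) Φ₀)
        hV hVindep hVlaw
        (hmodel.integrable_pderiv_score hΦ₀ i' i)) (I := I)
      (fun j j' => by
        rw [hfisher]
        exact hmodel.integral_dirScore_mul hΦ₀ j j')
    have hvec := ((PiLp.continuous_toLp 2 fun _ : IndIdx D g m => ℝ).tendsto 0).comp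
      (tendsto_pi_nhds.2 hcoord)
    refine tendstoInMeasure_of_tendsto_whp fun ε hε => ?_
    filter_upwards [Metric.tendsto_nhds.1 hvec ε hε] with p hp
    rw [dist_eq_norm] at hp
    refine lt_of_eq_of_lt (congrArg norm ?_) hp
    ext j
    simp [hpenred, Matrix.mulVec, dotProduct, mul_add]
  · refine (WithLp.measurable_toLp 2 _).comp_aemeasurable (aemeasurable_pi_lambda _ fun j => ?_)
    refine AEMeasurable.const_mul (AEMeasurable.add ?_ ((hgrad n j).const_mul _)) _
    refine Finset.aemeasurable_fun_sum _ fun j' _ => AEMeasurable.mul ?_ ?_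
    · exact aemeasurable_const.sub ((hhess n j j').const_mul _)
    · exact ((hmeas j'.1 n).sub measurable_const).aemeasurable
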